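/- Let $\mathfrak a(m)$ and $\xi(m)$, $m\in\mathbb N=\{1,2,\dots\}$, be mutually independent real random variables (all of them together) on a common probability space such that - for every $k\in\mathbb N$: $\sup_{m}\mathbb E[|\mathfrak a(m)|^k]<\infty$ and $\sup_{m}\mathbb E[|\xi(m)|^k]<\infty$; - for some $\mu_{\mathfrak a},\mu_\xi\in\mathbb R$: $\lim_{m\to\infty}\sqrt m\,\mathbb E[\mathfrak a(m)]=\mu_{\mathfrak a}$ and $\lim_{m\to\infty}\sqrt m\,\mathbb E[\xi(m)]=\mu_\xi$; - for some $s_{\mathfrak a},s_\xi\in(0,\infty)$: $\lim_{m\to\infty}\mathbb E[\mathfrak a(m)^2]=s_{\mathfrak a}^2$ and $\lim_{m\to\infty}\mathbb E[\xi(m)^2]=s_\xi^2$. For $n\ge 0$ let $M_n$ be the $n\times n$ symmetric tridiagonal matrix with diagonal entries $M_n[m,m]=\mathfrak a(m)$, $1\le m\le n$, and off-diagonal entries $M_n[m,m+1]=M_n[m+1,m]=\sqrt m+\xi(m)$, $1\le m\le n-1$. For $\alpha\in(0,1]$ and $k,N\in\mathbb N$ put $$X_N(\alpha,k)=\mathrm{Trace}\left(\left(\frac{M_{\lfloor\alpha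 N\rfloor}}{\sqrt N}\right)^{k}\right).$$ Then each $X_N(\alpha,k)$ is integrable and, as $N\to\infty$, every finite subfamily of $\{X_N(\alpha,k)-\mathbb E[X_N(\alpha,k)]:\ \alpha\in(0,1],\ k\in\mathbb N\}$ converges jointly in distribution to a centered Gaussian random vector, the covariance between the components with indices $(\alpha,k)$ and $(\alpha',k')$ being $$(\alpha\wedge\alpha')^{\frac{k+k'}2}\cdot\begin{cases} s_{\mathfrak a}^2\,\dfrac{2kk'}{k+k'}\dbinom{k-1}{(k-1)/2}\dbinom{k'-1}{(k'-1)/2}&\text{if }k,k'\text{ are both odd},\\[2mm] s_\xi^2\,\dfrac{2kk'}{k+k'}\dbinom{k}{k/2}\dbinom{k'}{k'/2}&\text{if }k,k'\text{ are both even},\\[2mm] 0&\text{if }k,k'\text{ have different parity.}\end{cases}$$ -/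

import Mathlib

open MeasureTheory ProbabilityTheory Filter Topology

noncomputable section

/-- The `N × N` symmetric tridiagonal matrix with diagonal entries `a 1, …, a N` and
off-diagonal entries `b 1, …, b (N - 1)`, where `b m = √m + ξ m`. The row and column
index `i : Fin N` stands for `i + 1 ∈ {1, …, N}`. -/
def tridiagonalMatrix {Ω : Type*} (a ξ : ℕ+ → Ω → ℝ) (N : ℕ) (ω : Ω) :
    Matrix (Fin N) (Fin N) ℝ :=
  Matrix.of fun i j =>
    if i = j then a (Nat.succPNat i) ω
    else if (i : ℕ) + 1 = j then √((Nat.succPNat i : ℕ) : ℝ) + ξ (Nat.succPNat i) ω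
    else if (j : ℕ) + 1 = i then √((Nat.succPNat j : ℕ) : ℝ) + ξ (Nat.succPNat j) ω
    else 0

/-- The random variable `Trace ((M_{⌊α N⌋} / √N) ^ k)`. -/
def scaledTrace {Ω : Type*} (a ξ : ℕ+ → Ω → ℝ) (α : ℝ) (k N : ℕ) (ω : Ω) : ℝ :=
  Matrix.trace (((√(N : ℝ))⁻¹ • tridiagonalMatrix a ξ ⌊α * N⌋₊ ω) ^ k)

/-- The limiting covariance of the centered traces with parameters `(α, k)` and `(α', k')`. -/
def limitCovariance (sa sξ α α' : ℝ) (k k' : ℕ) : ℝ :=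
  (min α α') ^ (((k : ℝ) + k') / 2) *
    if Odd k ∧ Odd k' then
      sa ^ 2 * (2 * k * k' / (k + k')) *
        ((k - 1).choose ((k - 1) / 2)) * ((k' - 1).choose ((k' - 1) / 2))
    else if Even k ∧ Even k' then
      sξ ^ 2 * (2 * k * k' / (k + k')) * (k.choose (k / 2)) * (k'.choose (k' / 2))
    else 0

end

/-! Write M_n / √N = A + N^{-1/2} B, where A (`meanMatrix`) is deterministic with entries √p / √N ≤
1 and B (`noiseMatrix`) carries the random variables. Then Tr (A + N^{-1/2} B)^k splits exactly
(`add_smul_pow_eq`) into Tr A^k, the linear term N^{-1/2} k Tr (B A^{k-1}), and N^{-1} times the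
trace of a remainder. Centering removes the first term.

The remainder is negligible. Its row p involves only noise within distance k of p, so its trace is a
sum of at most N variables with finite-range dependence and bounded moments. The variance of that
trace is O(N) (`LocalBounded.variance_trace_le`); after the factor N^{-1} it is O(1/N), so the
centered remainder tends to 0 in L¹.

The linear term is a weighted sum of independent variables. An entry of A^j near row xN is a sum
over ±1 walks whose edge weights all tend to √x, hence tends to √x^j times a number of walks
(`tendsto_entry_meanMatrix_pow`). The weights therefore have profiles in x, cut off at α, and a
Lyapunov estimate together with dominated convergence yields a Gaussian limit
(`tendsto_charFun_weighted_sum`). The covariance is an integral of products of profiles over (0, min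
α α'). Closed walks have even length, so the diagonal noise contributes only for odd powers and the
off-diagonal noise only for even ones (`integral_covarianceDensity`). Cramér–Wold gives the joint
statement. The means of the noise are O(m^{-1/2}), so μ_a and μ_ξ do not enter the limit. -/

noncomputable section

/-! ### Families of random variables with uniformly bounded moments -/

/-- All absolute moments of the family `X` are finite and bounded uniformly in the index. -/
structure MomentBounded {Ω J : Type*} [MeasurableSpace Ω] (P : Measure Ω) (X : J → Ω → ℝ) :
    Prop where
  measurable : ∀ j, Measurable (X j)
  bound : ∀ k : ℕ, ∃ C : ℝ, ∀ j,
    Integrable (fun ω => |X j ω| ^ k) P ∧ ∫ ω, |X j ω| ^ k ∂P ≤ C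

namespace MomentBounded

variable {Ω J J' : Type*} [MeasurableSpace Ω] {P : Measure Ω}

/-- A pointwise bound transfers to a bound on moments. -/
theorem of_abs_pow_le {X : J → Ω → ℝ} (hX : ∀ j, Measurable (X j))
    (h : ∀ k : ℕ, ∃ C : ℝ, ∀ j, ∃ g : Ω → ℝ, Integrable g P ∧ ∫ ω, g ω ∂P ≤ C ∧
      ∀ ω, |X j ω| ^ k ≤ g ω) : MomentBounded P X where
  measurable := hX
  bound k := by
    obtain ⟨C, hC⟩ := h k
    refine ⟨C, fun j => ?_⟩
    obtain ⟨g, hg, hgC, hle⟩ := hC j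
    have hint : Integrable (fun ω => |X j ω| ^ k) P := by
      refine hg.mono' (((hX j).abs.pow_const k).aestronglyMeasurable)
        (Eventually.of_forall fun ω => ?_)
      rw [Real.norm_eq_abs, abs_of_nonneg (by positivity)]
      exact hle ω
    exact ⟨hint, (integral_mono hint hg hle).trans hgC⟩

theorem comp {X : J → Ω → ℝ} (hX : MomentBounded P X) (f : J' → J) :
    MomentBounded P (fun j => X (f j)) where
  measurable j := hX.measurable _
  bound k := by
    obtain ⟨C, hC⟩ := hX.bound k
    exact ⟨C, fun j => hC _⟩

theorem const [IsProbabilityMeasure P] {c : J → ℝ} {C : ℝ} (h : ∀ j, |c j| ≤ C) :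
    MomentBounded P (fun j (_ : Ω) => c j) := by
  refine of_abs_pow_le (fun j => measurable_const) fun k => ⟨C ^ k, fun j =>
    ⟨fun _ => C ^ k, integrable_const _, by simp, fun ω => ?_⟩⟩
  exact pow_le_pow_left₀ (abs_nonneg _) (h j) k

/-- Closure under products is why moments of every order are required: |xy|^k ≤ |x|^{2k} + |y|^{2k},
so order k of the product costs order 2k of the factors. -/
theorem mul {X Y : J → Ω → ℝ} (hX : MomentBounded P X) (hY : MomentBounded P Y) :
    MomentBounded P (fun j ω => X j ω * Y j ω) := by
  refine of_abs_pow_le (fun j => (hX.measurable j).mul (hY.measurable j)) fun k => ?_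
  obtain ⟨C, hC⟩ := hX.bound (2 * k)
  obtain ⟨D, hD⟩ := hY.bound (2 * k)
  refine ⟨C + D, fun j => ⟨_, (hC j).1.add (hD j).1, ?_, fun ω => ?_⟩⟩
  · simp only [Pi.add_apply]
    rw [integral_add (hC j).1 (hD j).1]
    exact add_le_add (hC j).2 (hD j).2
  · simp only [Pi.add_apply, abs_mul, mul_pow, pow_mul']
    nlinarith [sq_nonneg (|X j ω| ^ k - |Y j ω| ^ k), sq_nonneg (|X j ω| ^ k),
      sq_nonneg (|Y j ω| ^ k)]

theorem add {X Y : J → Ω → ℝ} (hX : MomentBounded P X) (hY : MomentBounded P Y) :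
    MomentBounded P (fun j ω => X j ω + Y j ω) := by
  refine of_abs_pow_le (fun j => (hX.measurable j).add (hY.measurable j)) fun k => ?_
  obtain ⟨C, hC⟩ := hX.bound k
  obtain ⟨D, hD⟩ := hY.bound k
  refine ⟨2 ^ (k - 1) * (C + D), fun j => ⟨_, ((hC j).1.add (hD j).1).const_mul (2 ^ (k - 1)),
    ?_, fun ω => ?_⟩⟩
  · simp only [Pi.add_apply]
    rw [integral_const_mul, integral_add (hC j).1 (hD j).1]
    exact mul_le_mul_of_nonneg_left (add_le_add (hC j).2 (hD j).2) (by positivity)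
  · exact (pow_le_pow_left₀ (abs_nonneg _) (abs_add_le _ _) k).trans
      (add_pow_le (abs_nonneg _) (abs_nonneg _) k)

theorem const_mul [IsProbabilityMeasure P] {X : J → Ω → ℝ} (hX : MomentBounded P X)
    {c : J → ℝ} {C : ℝ} (h : ∀ j, |c j| ≤ C) :
    MomentBounded P (fun j ω => c j * X j ω) :=
  (const h).mul hX

theorem sq_bound {X : J → Ω → ℝ} (hX : MomentBounded P X) :
    ∃ C : ℝ, ∀ j, ∫ ω, X j ω ^ 2 ∂P ≤ C := by
  obtain ⟨C, hC⟩ := hX.bound 2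
  exact ⟨C, fun j => by simpa using (hC j).2⟩

theorem integrable {X : J → Ω → ℝ} (hX : MomentBounded P X) (j : J) : Integrable (X j) P := by
  obtain ⟨C, hC⟩ := hX.bound 1
  have := (hC j).1
  simp only [pow_one] at this
  exact (integrable_norm_iff (hX.measurable j).aestronglyMeasurable).1 this

theorem memLp_two {X : J → Ω → ℝ} (hX : MomentBounded P X) (j : J) : MemLp (X j) 2 P := by
  obtain ⟨C, hC⟩ := hX.bound 2
  refine (memLp_two_iff_integrable_sq (hX.measurable j).aestronglyMeasurable).2 ?_
  simpa using (hC j).1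

/-- Centering preserves uniform boundedness of moments. -/
theorem center [IsProbabilityMeasure P] {X : J → Ω → ℝ} (hX : MomentBounded P X) :
    MomentBounded P (fun j ω => X j ω - ∫ ω', X j ω' ∂P) := by
  obtain ⟨C, hC⟩ := hX.bound 1
  simp only [sub_eq_add_neg]
  refine hX.add (const (c := fun j => -∫ ω', X j ω' ∂P) (C := C) fun j => ?_)
  rw [abs_neg]
  refine (abs_integral_le_integral_abs).trans ?_
  simpa using (hC j).2

end MomentBounded

/-! ### Tridiagonal matrices -/

/-- The symmetric tridiagonal matrix with diagonal `d` and with `e p` coupling `p - 1` and `p`. -/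
def tridiag (n : ℕ) (d e : ℕ → ℝ) : Matrix (Fin n) (Fin n) ℝ :=
  Matrix.of fun i j =>
    if i = j then d i
    else if (i : ℕ) + 1 = j then e j
    else if (j : ℕ) + 1 = i then e i
    else 0

/-- The entries of a square matrix, extended by zero to all pairs of natural numbers. -/
def entry {n : ℕ} (X : Matrix (Fin n) (Fin n) ℝ) (p q : ℕ) : ℝ :=
  if h : p < n ∧ q < n then X ⟨p, h.1⟩ ⟨q, h.2⟩ else 0

/-- Truncation of a sequence. -/
def cutoff (n : ℕ) (d : ℕ → ℝ) (p : ℕ) : ℝ := if p < n then d p else 0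

theorem entry_val {n : ℕ} (X : Matrix (Fin n) (Fin n) ℝ) (i j : Fin n) : entry X i j = X i j := by
  simp [entry]

theorem entry_of_le_left {n : ℕ} (X : Matrix (Fin n) (Fin n) ℝ) {p q : ℕ} (h : n ≤ p) :
    entry X p q = 0 := by
  simp [entry, not_lt.2 h]

theorem entry_of_le_right {n : ℕ} (X : Matrix (Fin n) (Fin n) ℝ) {p q : ℕ} (h : n ≤ q) :
    entry X p q = 0 := by
  simp [entry, not_lt.2 h]

theorem entry_add {n : ℕ} (X Y : Matrix (Fin n) (Fin n) ℝ) (p q : ℕ) :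
    entry (X + Y) p q = entry X p q + entry Y p q := by
  unfold entry; split_ifs <;> simp

theorem entry_smul {n : ℕ} (c : ℝ) (X : Matrix (Fin n) (Fin n) ℝ) (p q : ℕ) :
    entry (c • X) p q = c * entry X p q := by
  unfold entry; split_ifs <;> simp

theorem entry_one (n p q : ℕ) :
    entry (1 : Matrix (Fin n) (Fin n) ℝ) p q = if p < n ∧ p = q then 1 else 0 := by
  unfold entry
  by_cases h : p < n ∧ q < n
  · simp [h, Matrix.one_apply]
  · rw [dif_neg h, if_neg (by rintro ⟨h1, rfl⟩; exact h ⟨h1, h1⟩)]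

theorem entry_zero (n p q : ℕ) : entry (0 : Matrix (Fin n) (Fin n) ℝ) p q = 0 := by
  simp [entry]

theorem trace_eq_sum_entry {n : ℕ} (X : Matrix (Fin n) (Fin n) ℝ) :
    X.trace = ∑ p ∈ Finset.range n, entry X p p := by
  rw [Finset.sum_range]
  simp [Matrix.trace, entry_val]

/-- With entries extended by zero, the row recursion has no boundary cases. At p = 0 the truncated
index p - 1 is harmless because e 0 = 0; for p ≥ n the cutoffs make the right side vanish. -/
theorem entry_tridiag_mul {n : ℕ} {d e : ℕ → ℝ} (he : e 0 = 0) (X : Matrix (Fin n) (Fin n) ℝ)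
    (p q : ℕ) :
    entry (tridiag n d e * X) p q =
      cutoff n d p * entry X p q + cutoff n e (p + 1) * entry X (p + 1) q
        + cutoff n e p * entry X (p - 1) q := by
  by_cases hp : p < n
  swap
  · have hp' := not_lt.1 hp
    simp [entry_of_le_left _ hp', cutoff, hp, not_lt.2 (hp'.trans (Nat.le_succ p))]
  by_cases hq : q < n
  swap
  · simp [entry_of_le_right _ (not_lt.1 hq)]
  have key : entry (tridiag n d e * X) p q = ∑ l ∈ Finset.range n,
      ((if p = l then d p * entry X l q else 0) + (if p + 1 = l then e l * entry X l q else 0)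
        + (if l + 1 = p then e p * entry X l q else 0)) := by
    rw [Finset.sum_range, entry, dif_pos ⟨hp, hq⟩, Matrix.mul_apply]
    refine Finset.sum_congr rfl fun l _ => ?_
    have hX : entry X l q = X l ⟨q, hq⟩ := by simp [entry, hq]
    simp only [tridiag, Matrix.of_apply, Fin.ext_iff, hX]
    split_ifs <;> first | omega | simp
  rw [key, Finset.sum_add_distrib, Finset.sum_add_distrib, Finset.sum_ite_eq, Finset.sum_ite_eq]
  simp only [Finset.mem_range, cutoff, hp, if_true]
  congr 1
  · congr 1
    split_ifs <;> simp
  · rcases p with _ | p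
    · simp [he]
    · simp only [add_left_inj, Nat.add_sub_cancel]
      rw [Finset.sum_ite_eq', if_pos (Finset.mem_range.2 (by omega))]

/-! ### Expansion of powers of a perturbed element -/

section Expansion

variable {R : Type*} [Ring R] [Algebra ℝ R]

/-- The derivative of `A ^ k` in direction `B`. -/
def powLinear (A B : R) : ℕ → R
  | 0 => 0
  | k + 1 => A * powLinear A B k + B * A ^ k

/-- The first order difference quotient of `(A + c • B) ^ k`. -/
def powQuot (A B : R) (c : ℝ) : ℕ → R
  | 0 => 0
  | k + 1 => A * powQuot A B c k + B * (A + c • B) ^ k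

/-- The second order remainder quotient of `(A + c • B) ^ k`. -/
def powRem (A B : R) (c : ℝ) : ℕ → R
  | 0 => 0
  | k + 1 => A * powRem A B c k + B * powQuot A B c k

theorem add_smul_pow (A B : R) (c : ℝ) (k : ℕ) :
    (A + c • B) ^ k = A ^ k + c • powQuot A B c k := by
  induction k with
  | zero => simp [powQuot]
  | succ k ih =>
    rw [pow_succ', powQuot, add_mul, smul_add, smul_mul_assoc, pow_succ' A]
    nth_rewrite 1 [ih]
    rw [mul_add, mul_smul_comm, add_assoc]

theorem powQuot_eq (A B : R) (c : ℝ) (k : ℕ) :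
    powQuot A B c k = powLinear A B k + c • powRem A B c k := by
  induction k with
  | zero => simp [powQuot, powLinear, powRem]
  | succ k ih =>
    rw [powQuot, powLinear, powRem, add_smul_pow, smul_add, mul_add B, mul_smul_comm]
    nth_rewrite 1 [ih]
    rw [mul_add, mul_smul_comm]
    abel

/-- An exact second-order expansion without commutativity. Peeling off the leftmost factor keeps the
remainder recursive: it is built by left multiplications by A and B only, under which locality and
moment bounds are stable. -/
theorem add_smul_pow_eq (A B : R) (c : ℝ) (k : ℕ) :
    (A + c • B) ^ k = A ^ k + c • powLinear A B k + c ^ 2 • powRem A B c k := by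
  rw [add_smul_pow, powQuot_eq, smul_add, smul_smul, sq, add_assoc]

end Expansion

/-- Cyclicity of the trace makes all k positions of B equivalent. The extra factor A ^ j is what
lets the induction run, since each unfolding of `powLinear` moves one A to the left. -/
theorem trace_pow_mul_powLinear {n : ℕ} (A B : Matrix (Fin n) (Fin n) ℝ) (j k : ℕ) :
    (A ^ j * powLinear A B k).trace = k * (B * A ^ (j + k - 1)).trace := by
  induction k generalizing j with
  | zero => simp [powLinear]
  | succ k ih =>
    rw [powLinear, mul_add, Matrix.trace_add, ← mul_assoc, ← pow_succ, ih (j + 1),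
      ← mul_assoc, Matrix.trace_mul_comm (A ^ j * B), ← mul_assoc, ← pow_add,
      Matrix.trace_mul_comm _ B]
    have h1 : j + 1 + k - 1 = j + k := by omega
    have h2 : j + (k + 1) - 1 = j + k := by omega
    rw [h1, h2, add_comm k j]
    push_cast
    ring

theorem trace_powLinear {n : ℕ} (A B : Matrix (Fin n) (Fin n) ℝ) (k : ℕ) :
    (powLinear A B k).trace = k * (B * A ^ (k - 1)).trace := by
  simpa using trace_pow_mul_powLinear A B 0 k

/-! ### A quantitative central limit theorem for characteristic functions -/

/-- Factors are exchanged one at a time; the others have norm at most 1. -/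
theorem norm_prod_sub_prod_le_sum {J : Type*} (s : Finset J) (f g : J → ℂ)
    (hf : ∀ j ∈ s, ‖f j‖ ≤ 1) (hg : ∀ j ∈ s, ‖g j‖ ≤ 1) :
    ‖∏ j ∈ s, f j - ∏ j ∈ s, g j‖ ≤ ∑ j ∈ s, ‖f j - g j‖ := by
  classical
  induction s using Finset.induction_on with
  | empty => simp
  | insert i s hi ih =>
    rw [Finset.prod_insert hi, Finset.prod_insert hi, Finset.sum_insert hi]
    have h1 := ih (fun j hj => hf j (Finset.mem_insert_of_mem hj))
      (fun j hj => hg j (Finset.mem_insert_of_mem hj))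
    have hF : ‖∏ j ∈ s, f j‖ ≤ 1 := by
      rw [norm_prod]
      exact Finset.prod_le_one (fun _ _ => norm_nonneg _)
        fun j hj => hf j (Finset.mem_insert_of_mem hj)
    have hG := hg i (Finset.mem_insert_self i s)
    have : f i * ∏ j ∈ s, f j - g i * ∏ j ∈ s, g j =
        (f i - g i) * ∏ j ∈ s, f j + g i * (∏ j ∈ s, f j - ∏ j ∈ s, g j) := by ring
    rw [this]
    refine (norm_add_le _ _).trans (add_le_add ?_ ?_)
    · rw [norm_mul]
      exact mul_le_of_le_one_right (norm_nonneg _) hF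
    · rw [norm_mul]
      exact (mul_le_of_le_one_left (norm_nonneg _) hG).trans h1

theorem norm_exp_mul_I_sub_le (x : ℝ) :
    ‖Complex.exp (x * Complex.I) - (1 + x * Complex.I - (x : ℂ) ^ 2 / 2)‖ ≤ 4 * |x| ^ 3 := by
  rcases le_or_gt |x| 1 with h | h
  · have hx : ‖(x : ℂ) * Complex.I‖ ≤ 1 := by simpa using h
    have := Complex.exp_bound hx (n := 3) (by norm_num)
    have hs : ∑ m ∈ Finset.range 3, ((x : ℂ) * Complex.I) ^ m / (m.factorial : ℂ) =
        1 + x * Complex.I - (x : ℂ) ^ 2 / 2 := by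
      simp [Finset.sum_range_succ, mul_pow]
      ring
    rw [hs] at this
    refine this.trans ?_
    simp [Nat.factorial]
    nlinarith [pow_nonneg (abs_nonneg x) 3]
  -- For |x| > 1 cancellation is not needed: 2 + |x| + |x|²/2 ≤ 4|x|³.
  · have h1 : ‖Complex.exp (x * Complex.I)‖ = 1 := Complex.norm_exp_ofReal_mul_I x
    have h2 : ‖(1 : ℂ) + x * Complex.I - (x : ℂ) ^ 2 / 2‖ ≤ 1 + |x| + |x| ^ 2 / 2 := by
      refine (norm_sub_le _ _).trans (add_le_add ((norm_add_le _ _).trans ?_) ?_) <;> simp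
    refine (norm_sub_le _ _).trans ?_
    rw [h1]
    nlinarith [mul_pos (sub_pos.2 h) (sub_pos.2 h), pow_pos (zero_lt_one.trans h) 2,
      mul_pos (zero_lt_one.trans h) (sub_pos.2 h),
      mul_pos (pow_pos (zero_lt_one.trans h) 2) (sub_pos.2 h)]

theorem abs_exp_neg_sub_le {y : ℝ} (hy : 0 ≤ y) : |Real.exp (-y) - (1 - y)| ≤ y ^ 2 := by
  have h1 : 1 - y ≤ Real.exp (-y) := by linarith [Real.add_one_le_exp (-y)]
  -- This rests on (1 + y)(1 - y + y²) = 1 + y³ ≥ 1.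
  have h2 : Real.exp (-y) ≤ 1 - y + y ^ 2 := by
    rw [Real.exp_neg, inv_le_iff_one_le_mul₀ (Real.exp_pos _)]
    have h3 : 1 + y ≤ Real.exp y := by linarith [Real.add_one_le_exp y]
    have h4 : 0 ≤ 1 - y + y ^ 2 := by nlinarith [sq_nonneg (y - 1)]
    nlinarith [mul_le_mul_of_nonneg_left h3 h4, pow_nonneg hy 3]
  rw [abs_of_nonneg (by linarith)]
  linarith

/-- Evaluation at 1 suffices throughout, since every frequency is absorbed into the coefficients of
a linear combination. -/
theorem charFun_map_eq_integral {Ω : Type*} [MeasurableSpace Ω] {P : Measure Ω}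
    {X : Ω → ℝ} (hX : Measurable X) :
    charFun (P.map X) 1 = ∫ ω, Complex.exp (X ω * Complex.I) ∂P := by
  rw [charFun_apply_real, integral_map hX.aemeasurable (by fun_prop)]
  simp

section CLT

variable {Ω : Type*} [MeasurableSpace Ω] {P : Measure Ω} [IsProbabilityMeasure P]

theorem integrable_exp_mul_I {X : Ω → ℝ} (hX : Measurable X) :
    Integrable (fun ω => Complex.exp (X ω * Complex.I)) P := by
  refine Integrable.of_bound (C := 1) (by fun_prop) (Eventually.of_forall fun ω => ?_)
  rw [Complex.norm_exp_ofReal_mul_I]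

/-- A single factor in Lyapunov's central limit theorem. -/
theorem norm_charFun_sub_exp_le {X : Ω → ℝ} (hX : Measurable X) (h1 : Integrable X P)
    (h2 : Integrable (fun ω => X ω ^ 2) P) (h3 : Integrable (fun ω => |X ω| ^ 3) P)
    (h0 : ∫ ω, X ω ∂P = 0) :
    ‖charFun (P.map X) 1 - Complex.exp (-((∫ ω, X ω ^ 2 ∂P : ℝ) / 2 : ℂ))‖ ≤
      4 * ∫ ω, |X ω| ^ 3 ∂P + (∫ ω, X ω ^ 2 ∂P) ^ 2 := by
  set v := ∫ ω, X ω ^ 2 ∂P with hv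
  have hv0 : 0 ≤ v := integral_nonneg fun ω => sq_nonneg _
  have e1 : Integrable (fun ω => (1 : ℂ) + X ω * Complex.I) P :=
    (integrable_const _).add (h1.ofReal.mul_const _)
  have e2 : Integrable (fun ω => (X ω : ℂ) ^ 2 / 2) P := by
    have : Integrable (fun ω => ((X ω ^ 2 : ℝ) : ℂ)) P := h2.ofReal
    simpa using this.div_const 2
  have e3 : Integrable (fun ω => (1 : ℂ) + X ω * Complex.I - (X ω : ℂ) ^ 2 / 2) P := e1.sub e2
  have hint : ∫ ω, ((1 : ℂ) + X ω * Complex.I - (X ω : ℂ) ^ 2 / 2) ∂P = (1 : ℂ) - (v : ℂ) / 2 := by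
    have i2 : ∫ ω, (X ω : ℂ) ^ 2 ∂P = (v : ℂ) := by
      rw [hv, ← integral_complex_ofReal]; simp
    rw [integral_sub e1 e2, integral_add (integrable_const _) (h1.ofReal.mul_const _),
      integral_mul_const, integral_complex_ofReal, h0, integral_div, i2]
    simp
  have k1 : ‖charFun (P.map X) 1 - ((1 : ℂ) - (v : ℂ) / 2)‖ ≤ 4 * ∫ ω, |X ω| ^ 3 ∂P := by
    rw [charFun_map_eq_integral hX, ← hint,
      ← integral_sub (integrable_exp_mul_I hX) e3, ← integral_const_mul]
    exact norm_integral_le_of_norm_le (h3.const_mul 4)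
      (Eventually.of_forall fun ω => norm_exp_mul_I_sub_le (X ω))
  have k2 : ‖Complex.exp (-((v : ℂ) / 2)) - ((1 : ℂ) - (v : ℂ) / 2)‖ ≤ v ^ 2 := by
    have : Complex.exp (-((v : ℂ) / 2)) - ((1 : ℂ) - (v : ℂ) / 2) =
        ((Real.exp (-(v / 2)) - (1 - v / 2) : ℝ) : ℂ) := by push_cast; ring
    rw [this, Complex.norm_real, Real.norm_eq_abs]
    refine (abs_exp_neg_sub_le (by positivity)).trans ?_
    nlinarith
  calc _ = ‖(charFun (P.map X) 1 - ((1 : ℂ) - (v : ℂ) / 2)) -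
        (Complex.exp (-((v : ℂ) / 2)) - ((1 : ℂ) - (v : ℂ) / 2))‖ := by congr 1; ring
    _ ≤ _ := (norm_sub_le _ _).trans (add_le_add k1 k2)

/-- Independence turns the characteristic function into a product, and the Gaussian one factors in
the same way, so the single-variable estimate is summed over the factors. -/
theorem norm_charFun_sum_sub_exp_le {J : Type*} {Z : J → Ω → ℝ} (hZ : MomentBounded P Z)
    (hind : iIndepFun Z P) (h0 : ∀ j, ∫ ω, Z j ω ∂P = 0) (s : Finset J) (c : J → ℝ) :
    ‖charFun (P.map fun ω => ∑ j ∈ s, c j * Z j ω) 1 -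
        Complex.exp (-((∑ j ∈ s, c j ^ 2 * ∫ ω, Z j ω ^ 2 ∂P : ℝ) / 2 : ℂ))‖ ≤
      ∑ j ∈ s, (4 * (|c j| ^ 3 * ∫ ω, |Z j ω| ^ 3 ∂P) + (c j ^ 2 * ∫ ω, Z j ω ^ 2 ∂P) ^ 2) := by
  have hm : ∀ j, Measurable fun ω => c j * Z j ω := fun j => (hZ.measurable j).const_mul _
  have hind' : iIndepFun (fun j ω => c j * Z j ω) P :=
    hind.comp (fun j x => c j * x) fun j => measurable_const_mul _
  have hprod : charFun (P.map fun ω => ∑ j ∈ s, c j * Z j ω) =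
      ∏ j ∈ s, charFun (P.map fun ω => c j * Z j ω) :=
    iIndepFun.charFun_map_fun_finsetSum_eq_prod (X := fun j ω => c j * Z j ω)
      (fun j _ => (hm j).aemeasurable) (hind'.restrict s)
  have hexp : Complex.exp (-((∑ j ∈ s, c j ^ 2 * ∫ ω, Z j ω ^ 2 ∂P : ℝ) / 2 : ℂ)) =
      ∏ j ∈ s, Complex.exp (-((∫ ω, (c j * Z j ω) ^ 2 ∂P : ℝ) / 2 : ℂ)) := by
    rw [← Complex.exp_sum]
    congr 1
    rw [Finset.sum_neg_distrib, ← Finset.sum_div]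
    simp [mul_pow, integral_const_mul]
  rw [hprod, hexp, Finset.prod_apply]
  refine (norm_prod_sub_prod_le_sum s _ _ (fun j _ => ?_) (fun j _ => ?_)).trans
    (Finset.sum_le_sum fun j _ => ?_)
  · have : IsProbabilityMeasure (P.map fun ω => c j * Z j ω) :=
      Measure.isProbabilityMeasure_map (hm j).aemeasurable
    exact norm_charFun_le_one _
  · rw [Complex.norm_exp, Real.exp_le_one_iff]
    have : 0 ≤ ∫ ω, (c j * Z j ω) ^ 2 ∂P := integral_nonneg fun ω => sq_nonneg _
    norm_cast
    linarith
  · obtain ⟨C3, hC3⟩ := hZ.bound 3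
    have key := norm_charFun_sub_exp_le (P := P) (hm j) ((hZ.integrable j).const_mul _)
      (by simpa [mul_pow] using ((hZ.memLp_two j).integrable_sq.const_mul (c j ^ 2)))
      (by simpa [mul_pow, abs_mul] using ((hC3 j).1.const_mul (|c j| ^ 3)))
      (by rw [integral_const_mul, h0, mul_zero])
    simpa only [mul_pow, abs_mul, integral_const_mul] using key

end CLT

/-! ### Riemann sums of locally constant functions -/

/-- The floor is constant on each unit cell; rescaling [0, N] to [0, 1] produces the factor 1/N. -/
theorem sum_div_eq_integral_floor (g : ℕ → ℝ) {N : ℕ} (hN : 0 < N) :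
    (N : ℝ)⁻¹ * ∑ m ∈ Finset.range N, g m = ∫ x in (0 : ℝ)..1, g ⌊(N : ℝ) * x⌋₊ := by
  have hN' : (N : ℝ) ≠ 0 := by positivity
  have hloc : ∀ m : ℕ, ∀ x ∈ Set.Ioo (m : ℝ) ((m + 1 : ℕ) : ℝ), g ⌊x⌋₊ = g m := by
    intro m x hx
    congr 1
    rw [Nat.floor_eq_iff (m.cast_nonneg.trans hx.1.le)]
    exact ⟨hx.1.le, by simpa using hx.2⟩
  have hae : ∀ m : ℕ, (fun _ => g m) =ᵐ[volume.restrict (Set.uIoc (m : ℝ) ((m + 1 : ℕ) : ℝ))]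
      fun x : ℝ => g ⌊x⌋₊ := by
    intro m
    rw [Set.uIoc_of_le (by simp), ← restrict_Ioo_eq_restrict_Ioc]
    exact (ae_restrict_iff' measurableSet_Ioo).2 (Eventually.of_forall fun x hx =>
      (hloc m x hx).symm)
  have h1 : ∀ m : ℕ, ∫ x in (m : ℝ)..((m + 1 : ℕ) : ℝ), g ⌊x⌋₊ = g m := by
    intro m
    rw [← intervalIntegral.integral_congr_ae_restrict (hae m)]
    simp
  have h2 : ∀ m < N, IntervalIntegrable (fun x : ℝ => g ⌊x⌋₊) volume (m : ℝ)
      ((m + 1 : ℕ) : ℝ) := fun m _ => (intervalIntegrable_const).congr_ae (hae m)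
  have h3 := intervalIntegral.sum_integral_adjacent_intervals (a := fun m : ℕ => (m : ℝ)) h2
  simp only [h1] at h3
  rw [h3, intervalIntegral.integral_comp_mul_left (fun x => g ⌊x⌋₊) hN']
  simp

/-- Dominated convergence for step functions. Asking for convergence only almost everywhere leaves
room for profiles that jump at a cutoff point. -/
theorem tendsto_riemann_sum {g : ℕ → ℕ → ℝ} {K : ℝ} (hK : ∀ N m, |g N m| ≤ K) {G : ℝ → ℝ}
    (hG : ∀ᵐ x : ℝ, x ∈ Set.Ioo (0 : ℝ) 1 →
      Tendsto (fun N : ℕ => g N ⌊(N : ℝ) * x⌋₊) atTop (𝓝 (G x))) :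
    Tendsto (fun N : ℕ => (N : ℝ)⁻¹ * ∑ m ∈ Finset.range N, g N m) atTop
      (𝓝 (∫ x in (0 : ℝ)..1, G x)) := by
  have h : Tendsto (fun N : ℕ => ∫ x in (0 : ℝ)..1, g N ⌊(N : ℝ) * x⌋₊) atTop
      (𝓝 (∫ x in (0 : ℝ)..1, G x)) := by
    refine intervalIntegral.tendsto_integral_filter_of_dominated_convergence (fun _ => K)
      (Eventually.of_forall fun N => ?_) (Eventually.of_forall fun N => ?_)
      intervalIntegrable_const ?_
    · have : Measurable fun x : ℝ => g N ⌊(N : ℝ) * x⌋₊ :=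
        measurable_from_nat.comp (Nat.measurable_floor.comp (measurable_const_mul _))
      exact this.aestronglyMeasurable
    · exact Eventually.of_forall fun x _ => hK N _
    · filter_upwards [hG, (measure_eq_zero_iff_ae_notMem.1 (Real.volume_singleton (a := 1)))]
        with x hx hx1 hx01
      rw [Set.uIoc_of_le zero_le_one] at hx01
      exact hx ⟨hx01.1, lt_of_le_of_ne hx01.2 hx1⟩
  refine h.congr' ?_
  filter_upwards [eventually_gt_atTop 0] with N hN
  exact (sum_div_eq_integral_floor (g N) hN).symm

theorem tendsto_floor_mul_atTop {x : ℝ} (hx : 0 < x) :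
    Tendsto (fun N : ℕ => ⌊(N : ℝ) * x⌋₊) atTop atTop :=
  tendsto_nat_floor_atTop.comp
    (tendsto_natCast_atTop_atTop.atTop_mul_const hx)

/-! ### Central limit theorem for weighted sums, and stability under L¹ perturbations -/

section LinearCLT

variable {Ω : Type*} [MeasurableSpace Ω] {P : Measure Ω} [IsProbabilityMeasure P]

/-- Central limit theorem for weighted sums `N^{-1/2} ∑ (u_N(m) Z_m + w_N(m) Z'_m)` whose weights
have profiles `U` and `W`. -/
theorem tendsto_charFun_weighted_sum {Z : ℕ ⊕ ℕ → Ω → ℝ} (hZ : MomentBounded P Z)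
    (hind : iIndepFun Z P) (h0 : ∀ j, ∫ ω, Z j ω ∂P = 0) {v v' : ℝ}
    (hv : Tendsto (fun m => ∫ ω, Z (.inl m) ω ^ 2 ∂P) atTop (𝓝 v))
    (hv' : Tendsto (fun m => ∫ ω, Z (.inr m) ω ^ 2 ∂P) atTop (𝓝 v'))
    {u w : ℕ → ℕ → ℝ} {K : ℝ} (hu : ∀ N m, |u N m| ≤ K) (hw : ∀ N m, |w N m| ≤ K)
    {U W : ℝ → ℝ}
    (hU : ∀ᵐ x : ℝ, x ∈ Set.Ioo (0 : ℝ) 1 →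
      Tendsto (fun N : ℕ => u N ⌊(N : ℝ) * x⌋₊) atTop (𝓝 (U x)))
    (hW : ∀ᵐ x : ℝ, x ∈ Set.Ioo (0 : ℝ) 1 →
      Tendsto (fun N : ℕ => w N ⌊(N : ℝ) * x⌋₊) atTop (𝓝 (W x))) :
    Tendsto (fun N : ℕ => charFun (P.map fun ω => (√(N : ℝ))⁻¹ * ∑ m ∈ Finset.range N,
        (u N m * Z (.inl m) ω + w N m * Z (.inr m) ω)) 1) atTop
      (𝓝 (Complex.exp (-((∫ x in (0 : ℝ)..1, (U x ^ 2 * v + W x ^ 2 * v') : ℝ) / 2 : ℂ)))) := by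
  obtain ⟨C3, hC3⟩ := hZ.bound 3
  obtain ⟨C2, hC2⟩ := hZ.sq_bound
  have hK0 : 0 ≤ K := (abs_nonneg _).trans (hu 0 0)
  have hZ2 : ∀ j, 0 ≤ ∫ ω, Z j ω ^ 2 ∂P := fun j => integral_nonneg fun ω => sq_nonneg _
  have hZ3 : ∀ j, 0 ≤ ∫ ω, |Z j ω| ^ 3 ∂P := fun j => integral_nonneg fun ω => by positivity
  have hC20 : 0 ≤ C2 := (hZ2 (.inl 0)).trans (hC2 _)
  have hC30 : 0 ≤ C3 := (hZ3 (.inl 0)).trans (hC3 _).2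
  set c : ℕ → ℕ ⊕ ℕ → ℝ := fun N j => (√(N : ℝ))⁻¹ * Sum.elim (u N) (w N) j with hc
  set s : ℕ → Finset (ℕ ⊕ ℕ) := fun N => (Finset.range N).disjSum (Finset.range N) with hs
  have hcK : ∀ N j, |c N j| ≤ (√(N : ℝ))⁻¹ * K := by
    intro N j
    rw [hc, abs_mul, abs_of_nonneg (by positivity : 0 ≤ (√(N : ℝ))⁻¹)]
    refine mul_le_mul_of_nonneg_left ?_ (by positivity)
    rcases j with m | m
    · exact hu N m
    · exact hw N m
  have hsum : ∀ (N : ℕ) ω, (√(N : ℝ))⁻¹ * ∑ m ∈ Finset.range N,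
      (u N m * Z (.inl m) ω + w N m * Z (.inr m) ω) = ∑ j ∈ s N, c N j * Z j ω := by
    intro N ω
    simp only [hs, Finset.sum_disjSum, hc, Sum.elim_inl, Sum.elim_inr]
    rw [Finset.sum_add_distrib, mul_add, Finset.mul_sum, Finset.mul_sum]
    simp only [mul_assoc]
  have hvar : ∀ N : ℕ, ∑ j ∈ s N, c N j ^ 2 * ∫ ω, Z j ω ^ 2 ∂P =
      (N : ℝ)⁻¹ * ∑ m ∈ Finset.range N, (u N m ^ 2 * ∫ ω, Z (.inl m) ω ^ 2 ∂P +
        w N m ^ 2 * ∫ ω, Z (.inr m) ω ^ 2 ∂P) := by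
    intro N
    simp only [hs, Finset.sum_disjSum, hc, Sum.elim_inl, Sum.elim_inr, mul_pow, inv_pow]
    rw [Real.sq_sqrt (Nat.cast_nonneg N), Finset.sum_add_distrib, mul_add, Finset.mul_sum,
      Finset.mul_sum]
    simp only [mul_assoc]
  have hvlim : Tendsto (fun N : ℕ => ∑ j ∈ s N, c N j ^ 2 * ∫ ω, Z j ω ^ 2 ∂P) atTop
      (𝓝 (∫ x in (0 : ℝ)..1, (U x ^ 2 * v + W x ^ 2 * v'))) := by
    simp only [hvar]
    refine tendsto_riemann_sum (K := K ^ 2 * C2 + K ^ 2 * C2) (fun N m => ?_) ?_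
    · rw [abs_of_nonneg (add_nonneg (mul_nonneg (sq_nonneg _) (hZ2 _))
        (mul_nonneg (sq_nonneg _) (hZ2 _)))]
      exact add_le_add
        (mul_le_mul (sq_le_sq.2 ((hu N m).trans (le_abs_self K))) (hC2 _) (hZ2 _) (sq_nonneg _))
        (mul_le_mul (sq_le_sq.2 ((hw N m).trans (le_abs_self K))) (hC2 _) (hZ2 _) (sq_nonneg _))
    · filter_upwards [hU, hW] with x hxU hxW hx
      have hfl := tendsto_floor_mul_atTop hx.1
      exact (((hxU hx).pow 2).mul (hv.comp hfl)).add (((hxW hx).pow 2).mul (hv'.comp hfl))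
  have herr : Tendsto (fun N : ℕ => ∑ j ∈ s N, (4 * (|c N j| ^ 3 * ∫ ω, |Z j ω| ^ 3 ∂P) +
      (c N j ^ 2 * ∫ ω, Z j ω ^ 2 ∂P) ^ 2)) atTop (𝓝 0) := by
    -- There are 2N terms, each at most 4 N^{-3/2} K³ C3 + N^{-2} K⁴ C2²; this explains the
    -- constants 8 and 2.
    have hlim : Tendsto (fun N : ℕ => (√(N : ℝ))⁻¹ * (8 * K ^ 3 * C3) +
        (N : ℝ)⁻¹ * (2 * K ^ 4 * C2 ^ 2)) atTop (𝓝 0) := by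
      have h1 : Tendsto (fun N : ℕ => (√(N : ℝ))⁻¹) atTop (𝓝 0) :=
        tendsto_inv_atTop_zero.comp (Real.tendsto_sqrt_atTop.comp tendsto_natCast_atTop_atTop)
      simpa using (h1.mul_const (8 * K ^ 3 * C3)).add
        (tendsto_inv_atTop_nhds_zero_nat.mul_const (2 * K ^ 4 * C2 ^ 2))
    refine squeeze_zero' (Eventually.of_forall fun N => Finset.sum_nonneg fun j _ =>
      add_nonneg (mul_nonneg (by norm_num) (mul_nonneg (by positivity) (hZ3 j))) (sq_nonneg _))
      ?_ hlim
    filter_upwards [eventually_gt_atTop 0] with N hN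
    have hb : ∀ j ∈ s N, 4 * (|c N j| ^ 3 * ∫ ω, |Z j ω| ^ 3 ∂P) +
        (c N j ^ 2 * ∫ ω, Z j ω ^ 2 ∂P) ^ 2 ≤
        4 * (((√(N : ℝ))⁻¹ * K) ^ 3 * C3) + (((√(N : ℝ))⁻¹ * K) ^ 2 * C2) ^ 2 := by
      intro j _
      have hcj := hcK N j
      have h2 : c N j ^ 2 ≤ ((√(N : ℝ))⁻¹ * K) ^ 2 := sq_le_sq.2 (hcj.trans (le_abs_self _))
      refine add_le_add (mul_le_mul_of_nonneg_left (mul_le_mul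
        (pow_le_pow_left₀ (abs_nonneg _) hcj 3) (hC3 j).2 (hZ3 j) (by positivity))
        (by norm_num)) (pow_le_pow_left₀ (mul_nonneg (sq_nonneg _) (hZ2 j))
          (mul_le_mul h2 (hC2 j) (hZ2 j) (sq_nonneg _)) 2)
    refine (Finset.sum_le_card_nsmul _ _ _ hb).trans (le_of_eq ?_)
    have hN0 : (0 : ℝ) < √(N : ℝ) := Real.sqrt_pos.2 (by exact_mod_cast hN)
    have hNs : (N : ℝ) = √(N : ℝ) ^ 2 := (Real.sq_sqrt (Nat.cast_nonneg N)).symm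
    have hcard : ((s N).card : ℝ) = 2 * √(N : ℝ) ^ 2 := by
      simp only [hs, Finset.card_disjSum, Finset.card_range]
      push_cast
      linarith
    rw [nsmul_eq_mul, hcard]
    generalize √(N : ℝ) = r at *
    rw [hNs]
    field_simp
    ring
  have hmain := squeeze_zero_norm (fun N : ℕ =>
    norm_charFun_sum_sub_exp_le hZ hind h0 (s N) (c N)) herr
  have hexp : Tendsto (fun N : ℕ => Complex.exp
      (-((∑ j ∈ s N, c N j ^ 2 * ∫ ω, Z j ω ^ 2 ∂P : ℝ) / 2 : ℂ))) atTop
      (𝓝 (Complex.exp (-((∫ x in (0 : ℝ)..1, (U x ^ 2 * v + W x ^ 2 * v') : ℝ) / 2 : ℂ)))) := by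
    refine (Complex.continuous_exp.tendsto _).comp ?_
    refine Tendsto.neg (Tendsto.div_const ?_ 2)
    exact (Complex.continuous_ofReal.tendsto _).comp hvlim
  simp only [hsum]
  simpa using hmain.add hexp

/-- From |e^{ir} - 1| ≤ |r|; it plays the role of Slutsky's lemma for the remainder. -/
theorem norm_charFun_add_sub_le {X R : Ω → ℝ} (hX : Measurable X) (hR : Measurable R)
    (hRi : Integrable R P) :
    ‖charFun (P.map fun ω => X ω + R ω) 1 - charFun (P.map X) 1‖ ≤ ∫ ω, |R ω| ∂P := by
  have hXR : Measurable fun ω => X ω + R ω := hX.add hR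
  rw [charFun_map_eq_integral hXR, charFun_map_eq_integral hX,
    ← integral_sub (integrable_exp_mul_I hXR) (integrable_exp_mul_I hX)]
  refine norm_integral_le_of_norm_le hRi.abs (Eventually.of_forall fun ω => ?_)
  have : Complex.exp (((X ω + R ω : ℝ) : ℂ) * Complex.I) - Complex.exp (X ω * Complex.I) =
      Complex.exp (X ω * Complex.I) * (Complex.exp (Complex.I * R ω) - 1) := by
    rw [mul_sub, ← Complex.exp_add, mul_one]
    push_cast
    ring_nf
  rw [this, norm_mul, Complex.norm_exp_ofReal_mul_I, one_mul]
  simpa using Real.norm_exp_I_mul_ofReal_sub_one_le (x := R ω)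

end LinearCLT

/-! ### Variance of sums of locally dependent variables -/

/-- Nonnegativity of Var (X - Y) gives 2 Cov (X, Y) ≤ Var X + Var Y. -/
theorem covariance_le_of_sq_le {Ω : Type*} [MeasurableSpace Ω] {P : Measure Ω}
    [IsProbabilityMeasure P] {X Y : Ω → ℝ} (hX : MemLp X 2 P) (hY : MemLp Y 2 P) {C : ℝ}
    (hXC : ∫ ω, X ω ^ 2 ∂P ≤ C) (hYC : ∫ ω, Y ω ^ 2 ∂P ≤ C) :
    covariance X Y P ≤ C := by
  have h1 := variance_nonneg (X - Y) P
  rw [variance_sub hX hY] at h1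
  have h2 := variance_le_expectation_sq hX.aestronglyMeasurable
  have h3 := variance_le_expectation_sq hY.aestronglyMeasurable
  simp only [Pi.pow_apply] at h2 h3
  linarith

/-- In each row of the covariance matrix at most 2D + 1 entries are nonzero, so the growth is linear
in n instead of quadratic. -/
theorem variance_sum_le_of_indep_far {Ω : Type*} [MeasurableSpace Ω] {P : Measure Ω}
    [IsProbabilityMeasure P] {X : ℕ → Ω → ℝ} (hX : ∀ p, MemLp (X p) 2 P) {C : ℝ}
    (hC : ∀ p, ∫ ω, X p ω ^ 2 ∂P ≤ C) {D : ℕ}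
    (hind : ∀ p p', p + D < p' → IndepFun (X p) (X p') P) (n : ℕ) :
    variance (fun ω => ∑ p ∈ Finset.range n, X p ω) P ≤ n * ((2 * D + 1) * C) := by
  have hC0 : 0 ≤ C := (integral_nonneg fun ω => sq_nonneg _).trans (hC 0)
  rw [variance_fun_sum' fun p _ => hX p]
  have key : ∀ p ∈ Finset.range n, ∑ p' ∈ Finset.range n, covariance (X p) (X p') P ≤
      (2 * D + 1) * C := by
    intro p _
    calc ∑ p' ∈ Finset.range n, covariance (X p) (X p') P
        ≤ ∑ p' ∈ Finset.range n, if p' ∈ Finset.Icc (p - D) (p + D) then C else 0 := by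
          refine Finset.sum_le_sum fun p' _ => ?_
          split_ifs with h
          · exact covariance_le_of_sq_le (hX p) (hX p') (hC p) (hC p')
          · rw [Finset.mem_Icc, not_and_or, not_le, not_le] at h
            rcases h with h | h
            · rw [covariance_comm, (hind p' p (by omega)).covariance_eq_zero (hX p') (hX p)]
            · rw [(hind p p' (by omega)).covariance_eq_zero (hX p) (hX p')]
      _ ≤ ∑ p' ∈ Finset.Icc (p - D) (p + D), C := by
          rw [← Finset.sum_filter]
          refine Finset.sum_le_sum_of_subset_of_nonneg (fun x hx => (Finset.mem_filter.1 hx).2)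
            fun _ _ _ => hC0
      _ ≤ (2 * D + 1) * C := by
          rw [Finset.sum_const, nsmul_eq_mul, Nat.card_Icc]
          refine mul_le_mul_of_nonneg_right ?_ hC0
          have : p + D + 1 - (p - D) ≤ 2 * D + 1 := by omega
          exact_mod_cast this
  refine (Finset.sum_le_sum key).trans (le_of_eq ?_)
  simp

/-! ### Local families of random matrices -/

section Local

/-- The σ-algebra generated by the variables whose site is within distance `r` of `p`. -/
@[reducible]
def localSigma {Ω : Type*} (Z : ℕ ⊕ ℕ → Ω → ℝ) (p r : ℕ) : MeasurableSpace Ω :=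
  ⨆ j ∈ {j : ℕ ⊕ ℕ | p ≤ Sum.elim id id j + r ∧ Sum.elim id id j ≤ p + r},
    MeasurableSpace.comap (Z j) inferInstance

theorem localSigma_le {Ω : Type*} {Z : ℕ ⊕ ℕ → Ω → ℝ} {p r p' r' : ℕ} (h1 : p' + r ≤ p + r')
    (h2 : p + r ≤ p' + r') : localSigma Z p r ≤ localSigma Z p' r' := by
  refine biSup_mono fun j hj => ?_
  simp only [Set.mem_ofPred_eq] at hj ⊢
  omega

theorem measurable_localSigma {Ω : Type*} {Z : ℕ ⊕ ℕ → Ω → ℝ} {p r : ℕ} {j : ℕ ⊕ ℕ}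
    (h1 : p ≤ Sum.elim id id j + r) (h2 : Sum.elim id id j ≤ p + r) :
    Measurable[localSigma Z p r] (Z j) :=
  (comap_measurable (Z j)).mono
    (le_biSup (fun j => MeasurableSpace.comap (Z j) inferInstance) (show j ∈ {j : ℕ ⊕ ℕ |
      p ≤ Sum.elim id id j + r ∧ Sum.elim id id j ≤ p + r} from ⟨h1, h2⟩)) le_rfl

variable {Ω : Type*} [MeasurableSpace Ω]

/-- Windows of radius r around sites more than 2r apart share no noise variable. -/
theorem indepFun_of_localSigma {P : Measure Ω} {Z : ℕ ⊕ ℕ → Ω → ℝ} (hZ : ∀ j, Measurable (Z j))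
    (hind : iIndepFun Z P) {X Y : Ω → ℝ} {p p' r : ℕ} (hX : Measurable[localSigma Z p r] X)
    (hY : Measurable[localSigma Z p' r] Y) (h : p + 2 * r < p') : IndepFun X Y P := by
  have hI : Indep (localSigma Z p r) (localSigma Z p' r) P := by
    refine indep_iSup_of_disjoint (fun j => (hZ j).comap_le) hind.iIndep ?_
    rw [Set.disjoint_left]
    intro j hj hj'
    simp only [Set.mem_ofPred_eq] at hj hj'
    omega
  rw [IndepFun_iff_Indep]
  exact indep_of_indep_of_le_left (indep_of_indep_of_le_right hI hY.comap_le) hX.comap_le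

/-- A sequence of random matrices with uniformly bounded moments all of whose entries in row `p`
depend only on the variables within distance `r` of `p`. -/
structure LocalBounded (P : Measure Ω) (Z : ℕ ⊕ ℕ → Ω → ℝ) (n : ℕ → ℕ) (r : ℕ)
    (X : (N : ℕ) → Ω → Matrix (Fin (n N)) (Fin (n N)) ℝ) : Prop where
  bounded : MomentBounded P fun (j : ℕ × ℕ × ℕ) ω => entry (X j.1 ω) j.2.1 j.2.2
  isLocal : ∀ N p q, Measurable[localSigma Z p r] fun ω => entry (X N ω) p q

namespace LocalBounded

variable {P : Measure Ω} {Z : ℕ ⊕ ℕ → Ω → ℝ} {n : ℕ → ℕ} {r : ℕ}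
  {X Y : (N : ℕ) → Ω → Matrix (Fin (n N)) (Fin (n N)) ℝ}

theorem add (hX : LocalBounded P Z n r X) (hY : LocalBounded P Z n r Y) :
    LocalBounded P Z n r fun N ω => X N ω + Y N ω where
  bounded := by simpa only [entry_add] using hX.bounded.add hY.bounded
  isLocal N p q := by
    simp only [entry_add]
    exact (hX.isLocal N p q).add (hY.isLocal N p q)

theorem smul [IsProbabilityMeasure P] (hX : LocalBounded P Z n r X) {c : ℕ → ℝ} {C : ℝ}
    (hc : ∀ N, |c N| ≤ C) : LocalBounded P Z n r fun N ω => c N • X N ω where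
  bounded := by
    simpa only [entry_smul] using hX.bounded.const_mul (c := fun j => c j.1) fun j => hc j.1
  isLocal N p q := by simpa only [entry_smul] using (hX.isLocal N p q).const_mul _

theorem zero [IsProbabilityMeasure P] : LocalBounded P Z n r fun _ _ => 0 where
  bounded := by
    simpa only [entry_zero] using MomentBounded.const (c := fun _ => 0) (C := 0) (by simp)
  isLocal N p q := by simpa only [entry_zero] using measurable_const

theorem one [IsProbabilityMeasure P] : LocalBounded P Z n r fun _ _ => 1 where
  bounded := by
    simp only [entry_one]
    exact MomentBounded.const (C := 1) fun j => by split_ifs <;> simp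
  isLocal N p q := by simpa only [entry_one] using measurable_const

/-- Row p of the product reads only rows p - 1, p, p + 1 of X, so the radius grows by one, whatever
the column. The coupling at p + 1 also enters row p, hence the separate hypothesis `hel'`. -/
theorem tridiag_mul {d e : ℕ → Ω → ℕ → ℝ} (he0 : ∀ N ω, e N ω 0 = 0)
    (hd : MomentBounded P fun (j : ℕ × ℕ) ω => cutoff (n j.1) (d j.1 ω) j.2)
    (he : MomentBounded P fun (j : ℕ × ℕ) ω => cutoff (n j.1) (e j.1 ω) j.2)
    (hdl : ∀ N p, Measurable[localSigma Z p 1] fun ω => d N ω p)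
    (hel : ∀ N p, Measurable[localSigma Z p 1] fun ω => e N ω p)
    (hel' : ∀ N p, Measurable[localSigma Z p 1] fun ω => e N ω (p + 1))
    (hX : LocalBounded P Z n r X) :
    LocalBounded P Z n (r + 1) fun N ω => tridiag (n N) (d N ω) (e N ω) * X N ω where
  bounded := by
    simp only [entry_tridiag_mul (he0 _ _)]
    refine (((hd.comp fun j => (j.1, j.2.1)).mul hX.bounded).add
      ((he.comp fun j => (j.1, j.2.1 + 1)).mul
        (hX.bounded.comp fun j => (j.1, j.2.1 + 1, j.2.2)))).add
      ((he.comp fun j => (j.1, j.2.1)).mul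
        (hX.bounded.comp fun j => (j.1, j.2.1 - 1, j.2.2)))
  isLocal N p q := by
    simp only [entry_tridiag_mul (he0 _ _)]
    have hcut : ∀ {f : Ω → ℕ → ℝ} {p' : ℕ}, (Measurable[localSigma Z p 1] fun ω => f ω p') →
        Measurable[localSigma Z p (r + 1)] fun ω => cutoff (n N) (f ω) p' := by
      intro f p' hf
      unfold cutoff
      split_ifs
      · exact hf.mono (localSigma_le (by omega) (by omega)) le_rfl
      · exact measurable_const
    have hent : ∀ p', p ≤ p' + 1 → p' ≤ p + 1 →
        Measurable[localSigma Z p (r + 1)] fun ω => entry (X N ω) p' q := fun p' h1 h2 =>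
      (hX.isLocal N p' q).mono (localSigma_le (by omega) (by omega)) le_rfl
    exact (((hcut (hdl N p)).mul (hent p (by omega) (by omega))).add
      ((hcut (hel' N p)).mul (hent (p + 1) (by omega) (by omega)))).add
      ((hcut (hel N p)).mul (hent (p - 1) (by omega) (by omega)))

theorem variance_trace_le [IsProbabilityMeasure P] (hZ : ∀ j, Measurable (Z j))
    (hind : iIndepFun Z P) (hX : LocalBounded P Z n r X) :
    ∃ C : ℝ, ∀ N, variance (fun ω => (X N ω).trace) P ≤ n N * C := by
  obtain ⟨C, hC⟩ := hX.bounded.sq_bound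
  refine ⟨(2 * (2 * r : ℕ) + 1) * C, fun N => ?_⟩
  simp only [trace_eq_sum_entry]
  exact variance_sum_le_of_indep_far (fun p => hX.bounded.memLp_two (N, p, p))
    (fun p => hC (N, p, p))
    (fun p p' h => indepFun_of_localSigma hZ hind (hX.isLocal N p p) (hX.isLocal N p' p') h) _

theorem memLp_trace (hX : LocalBounded P Z n r X) (N : ℕ) :
    MemLp (fun ω => (X N ω).trace) 2 P := by
  simp only [trace_eq_sum_entry]
  exact memLp_finsetSum _ fun p _ => hX.bounded.memLp_two (N, p, p)

theorem measurable_trace (hX : LocalBounded P Z n r X) (N : ℕ) :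
    Measurable fun ω => (X N ω).trace := by
  simp only [trace_eq_sum_entry]
  exact Finset.measurable_sum _ fun p _ => hX.bounded.measurable (N, p, p)

end LocalBounded

/-! ### The random tridiagonal matrix and its expansion -/

/-- The deterministic part of the matrix `M_n / √N`. -/
def meanMatrix (N n : ℕ) : Matrix (Fin n) (Fin n) ℝ :=
  tridiag n (fun _ => 0) fun p => √(p : ℝ) / √(N : ℝ)

/-- The sequence `0, f 0, f 1, …`. -/
def shiftRight (f : ℕ → ℝ) : ℕ → ℝ
  | 0 => 0
  | p + 1 => f p

/-- The random part of the matrix `M_n`. -/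
def noiseMatrix (Z : ℕ ⊕ ℕ → Ω → ℝ) (n : ℕ) (ω : Ω) : Matrix (Fin n) (Fin n) ℝ :=
  tridiag n (fun p => Z (.inl p) ω) (shiftRight fun p => Z (.inr p) ω)

theorem abs_cutoff_sqrt_div_le {N n : ℕ} (h : n ≤ N) (p : ℕ) :
    |cutoff n (fun p => √(p : ℝ) / √(N : ℝ)) p| ≤ 1 := by
  unfold cutoff
  split_ifs with hp
  · rw [abs_of_nonneg (by positivity)]
    refine div_le_one_of_le₀ (Real.sqrt_le_sqrt ?_) (Real.sqrt_nonneg _)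
    exact_mod_cast (hp.le.trans h)
  · simp

variable {P : Measure Ω} [IsProbabilityMeasure P] {Z : ℕ ⊕ ℕ → Ω → ℝ} {n : ℕ → ℕ} {r : ℕ}
  {X : (N : ℕ) → Ω → Matrix (Fin (n N)) (Fin (n N)) ℝ}

theorem LocalBounded.meanMatrix_mul (hn : ∀ N, n N ≤ N) (hX : LocalBounded P Z n r X) :
    LocalBounded P Z n (r + 1) fun N ω => meanMatrix N (n N) * X N ω :=
  LocalBounded.tridiag_mul (d := fun _ _ _ => 0) (e := fun N _ p => √(p : ℝ) / √(N : ℝ))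
    (by simp) (MomentBounded.const (C := 0) (by simp [cutoff]))
    (MomentBounded.const (C := 1) fun j => abs_cutoff_sqrt_div_le (hn _) _)
    (fun _ _ => measurable_const) (fun _ _ => measurable_const) (fun _ _ => measurable_const) hX

theorem LocalBounded.noiseMatrix_mul (hZ : MomentBounded P Z) (hX : LocalBounded P Z n r X) :
    LocalBounded P Z n (r + 1) fun N ω => noiseMatrix Z (n N) ω * X N ω := by
  have hind : ∀ n p : ℕ, |if p < n then (1 : ℝ) else 0| ≤ 1 := fun n p => by
    split_ifs <;> simp
  have hcut : ∀ (n : ℕ) (f : ℕ → ℝ) p, cutoff n f p = (if p < n then 1 else 0) * f p := by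
    intro n f p
    simp [cutoff]
  refine LocalBounded.tridiag_mul (d := fun _ ω p => Z (.inl p) ω)
    (e := fun _ ω => shiftRight fun p => Z (.inr p) ω) (fun _ _ => rfl) ?_ ?_ ?_ ?_ ?_ hX
  · simp only [hcut]
    exact (hZ.comp fun j : ℕ × ℕ => Sum.inl j.2).const_mul fun j => hind (n j.1) j.2
  · have hs : ∀ (p : ℕ) (ω : Ω), shiftRight (fun p => Z (.inr p) ω) p =
        (if p = 0 then 0 else 1) * Z (.inr (p - 1)) ω := by
      rintro (_ | p) ω <;> simp [shiftRight]
    simp only [hcut, hs]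
    exact ((hZ.comp fun j : ℕ × ℕ => Sum.inr (j.2 - 1)).const_mul
      (c := fun j => if j.2 = 0 then 0 else 1) (C := 1)
      (fun j => by split_ifs <;> simp)).const_mul fun j => hind (n j.1) j.2
  · intro _ p
    exact measurable_localSigma (by simp) (by simp)
  -- The coupling between p and p + 1 is stored at site p, so seen from row p + 1 it lies at
  -- distance 1.
  · rintro _ (_ | p)
    · exact measurable_const
    · exact measurable_localSigma (j := .inr p) (by simp) (by simp; omega)
  · intro _ p
    exact measurable_localSigma (j := .inr p) (by simp) (by simp)

theorem abs_inv_sqrt_natCast_le (N : ℕ) : |(√(N : ℝ))⁻¹| ≤ 1 := by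
  rw [abs_of_nonneg (by positivity)]
  rcases Nat.eq_zero_or_pos N with rfl | h
  · simp
  · exact inv_le_one_of_one_le₀ (Real.one_le_sqrt.2 (by exact_mod_cast h))

theorem localBounded_pow (hZ : MomentBounded P Z) (hn : ∀ N, n N ≤ N) (k : ℕ) :
    LocalBounded P Z n k fun N ω =>
      (meanMatrix N (n N) + (√(N : ℝ))⁻¹ • noiseMatrix Z (n N) ω) ^ k := by
  induction k with
  | zero => simpa only [pow_zero] using LocalBounded.one
  | succ k ih =>
    simp only [pow_succ', add_mul, smul_mul_assoc]
    exact (ih.meanMatrix_mul hn).add ((ih.noiseMatrix_mul hZ).smul abs_inv_sqrt_natCast_le)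

theorem localBounded_powQuot (hZ : MomentBounded P Z) (hn : ∀ N, n N ≤ N) (k : ℕ) :
    LocalBounded P Z n k fun N ω =>
      powQuot (meanMatrix N (n N)) (noiseMatrix Z (n N) ω) (√(N : ℝ))⁻¹ k := by
  induction k with
  | zero => simpa only [powQuot] using LocalBounded.zero
  | succ k ih =>
    simp only [powQuot]
    exact (ih.meanMatrix_mul hn).add ((localBounded_pow hZ hn k).noiseMatrix_mul hZ)

theorem localBounded_powRem (hZ : MomentBounded P Z) (hn : ∀ N, n N ≤ N) (k : ℕ) :
    LocalBounded P Z n k fun N ω =>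
      powRem (meanMatrix N (n N)) (noiseMatrix Z (n N) ω) (√(N : ℝ))⁻¹ k := by
  induction k with
  | zero => simpa only [powRem] using LocalBounded.zero
  | succ k ih =>
    simp only [powRem]
    exact (ih.meanMatrix_mul hn).add ((localBounded_powQuot hZ hn k).noiseMatrix_mul hZ)

end Local

/-! ### Powers of the deterministic matrix -/

/-- The number of `±1` walks of length `j` with displacement `d`. -/
def walkCount : ℕ → ℤ → ℝ
  | 0, d => if d = 0 then 1 else 0
  | j + 1, d => walkCount j (d - 1) + walkCount j (d + 1)

theorem walkCount_of_lt (j : ℕ) : ∀ d : ℤ, d < -j → walkCount j d = 0 := by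
  induction j with
  | zero => intro d hd; simp only [walkCount]; rw [if_neg]; simp at hd; omega
  | succ j ih =>
    intro d hd
    push_cast at hd
    rw [walkCount, ih _ (by omega), ih _ (by omega), add_zero]

/-- A walk with s up-steps has displacement 2s - j, and the recursion becomes Pascal's rule. For s =
0 one of the two predecessors is out of reach. -/
theorem walkCount_two_mul_sub (j : ℕ) : ∀ s : ℕ, walkCount j (2 * s - j) = j.choose s := by
  induction j with
  | zero => rintro (_ | s) <;> simp [walkCount]; omega
  | succ j ih =>
    rintro (_ | s)
    · rw [walkCount, walkCount_of_lt j _ (by push_cast; omega)]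
      have := ih 0
      push_cast at this ⊢
      rw [show (0 - ((j : ℤ) + 1) + 1) = 0 - j by ring, this]
      simp
    · have h1 := ih s
      have h2 := ih (s + 1)
      rw [walkCount, Nat.choose_succ_succ]
      push_cast at h1 h2 ⊢
      rw [show (2 * ((s : ℤ) + 1) - (j + 1) - 1) = 2 * s - j by ring, h1,
        show (2 * ((s : ℤ) + 1) - (j + 1) + 1) = 2 * (s + 1) - j by ring, h2]

theorem walkCount_of_odd (j : ℕ) : ∀ d : ℤ, Odd (j + d) → walkCount j d = 0 := by
  induction j with
  | zero =>
    intro d hd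
    rw [walkCount, if_neg]
    rintro rfl
    simp at hd
  | succ j ih =>
    intro d hd
    rw [walkCount, ih _ (by grind), ih _ (by grind), add_zero]

theorem walkCount_zero_of_odd {j : ℕ} (h : Odd j) : walkCount j 0 = 0 :=
  walkCount_of_odd j 0 (by simpa using h)

theorem walkCount_zero_of_even {j : ℕ} (h : Even j) : walkCount j 0 = j.choose (j / 2) := by
  rw [← walkCount_two_mul_sub]
  congr 1
  have := Nat.two_mul_div_two_of_even h
  omega

theorem entry_meanMatrix_mul {N n : ℕ} (X : Matrix (Fin n) (Fin n) ℝ) (p q : ℕ) :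
    entry (meanMatrix N n * X) p q =
      cutoff n (fun p => √(p : ℝ) / √(N : ℝ)) (p + 1) * entry X (p + 1) q
        + cutoff n (fun p => √(p : ℝ) / √(N : ℝ)) p * entry X (p - 1) q := by
  rw [meanMatrix, entry_tridiag_mul (by simp)]
  simp [cutoff]

theorem abs_entry_meanMatrix_pow_le {N n : ℕ} (h : n ≤ N) (j p q : ℕ) :
    |entry (meanMatrix N n ^ j) p q| ≤ 2 ^ j := by
  induction j generalizing p q with
  | zero => rw [pow_zero, entry_one]; split_ifs <;> simp
  | succ j ih =>
    rw [pow_succ', entry_meanMatrix_mul, pow_succ', two_mul]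
    refine (abs_add_le _ _).trans (add_le_add ?_ ?_) <;> rw [abs_mul]
    · simpa using mul_le_mul (abs_cutoff_sqrt_div_le h (p + 1)) (ih _ _) (abs_nonneg _) zero_le_one
    · simpa using mul_le_mul (abs_cutoff_sqrt_div_le h p) (ih _ _) (abs_nonneg _) zero_le_one

theorem eventually_lt_of_tendsto_div {p n : ℕ → ℕ} {x α : ℝ}
    (hp : Tendsto (fun N => (p N : ℝ) / N) atTop (𝓝 x))
    (hn : Tendsto (fun N => (n N : ℝ) / N) atTop (𝓝 α)) (h : x < α) : ∀ᶠ N in atTop, p N < n N := by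
  filter_upwards [hp.eventually_lt hn h, eventually_gt_atTop 0] with N hN hN0
  have : (0 : ℝ) < N := by exact_mod_cast hN0
  exact_mod_cast (div_lt_div_iff_of_pos_right this).1 hN

theorem tendsto_natCast_add_one_div {p : ℕ → ℕ} {x : ℝ}
    (hp : Tendsto (fun N => (p N : ℝ) / N) atTop (𝓝 x)) :
    Tendsto (fun N => ((p N + 1 : ℕ) : ℝ) / N) atTop (𝓝 x) := by
  simpa [add_div] using hp.add (tendsto_inv_atTop_nhds_zero_nat (𝕜 := ℝ))

theorem eventually_pos_of_tendsto_div {p : ℕ → ℕ} {x : ℝ}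
    (hp : Tendsto (fun N => (p N : ℝ) / N) atTop (𝓝 x)) (hx : 0 < x) : ∀ᶠ N in atTop, 0 < p N :=
  eventually_lt_of_tendsto_div (p := fun _ => 0) (by simp) hp hx

theorem tendsto_natCast_sub_one_div {p : ℕ → ℕ} {x : ℝ}
    (hp : Tendsto (fun N => (p N : ℝ) / N) atTop (𝓝 x)) (hx : 0 < x) :
    Tendsto (fun N => ((p N - 1 : ℕ) : ℝ) / N) atTop (𝓝 x) := by
  have h : Tendsto (fun N => (p N : ℝ) / N - (N : ℝ)⁻¹) atTop (𝓝 x) := by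
    simpa using hp.sub (tendsto_inv_atTop_nhds_zero_nat (𝕜 := ℝ))
  refine h.congr' ?_
  filter_upwards [eventually_pos_of_tendsto_div hp hx] with N hN
  rw [Nat.cast_sub hN, sub_div, Nat.cast_one, one_div]

theorem tendsto_cutoff_sqrt_div {p n : ℕ → ℕ} {x α : ℝ}
    (hp : Tendsto (fun N => (p N : ℝ) / N) atTop (𝓝 x))
    (hn : Tendsto (fun N => (n N : ℝ) / N) atTop (𝓝 α)) (h : x < α) :
    Tendsto (fun N : ℕ => cutoff (n N) (fun p => √(p : ℝ) / √(N : ℝ)) (p N)) atTop (𝓝 √x) := by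
  refine ((Real.continuous_sqrt.tendsto x).comp hp).congr' ?_
  filter_upwards [eventually_lt_of_tendsto_div hp hn h] with N hN
  rw [cutoff, if_pos hN, Function.comp_apply, Real.sqrt_div (Nat.cast_nonneg _)]

/-- All edges used by a walk of length j near row xN have weight tending to √x, and since 0 < x < α
the walk eventually stays clear of both ends. The row sequence p is arbitrary so that the induction
may pass to p ± 1. -/
theorem tendsto_entry_meanMatrix_pow {n : ℕ → ℕ} {α x : ℝ} (hx : 0 < x) (hxα : x < α)
    (hn : Tendsto (fun N => (n N : ℝ) / N) atTop (𝓝 α)) (j : ℕ) {p q : ℕ → ℕ} {d : ℤ}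
    (hp : Tendsto (fun N => (p N : ℝ) / N) atTop (𝓝 x))
    (hd : ∀ᶠ N in atTop, (q N : ℤ) - p N = d) :
    Tendsto (fun N => entry (meanMatrix N (n N) ^ j) (p N) (q N)) atTop
      (𝓝 (√x ^ j * walkCount j d)) := by
  induction j generalizing p d with
  | zero =>
    refine tendsto_const_nhds.congr' ?_
    filter_upwards [hd, eventually_lt_of_tendsto_div hp hn hxα] with N hN hlt
    rw [pow_zero, pow_zero, one_mul, entry_one, walkCount]
    refine if_congr ?_ rfl rfl
    omega
  | succ j ih =>
    have hp1 := tendsto_natCast_add_one_div hp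
    have hp2 := tendsto_natCast_sub_one_div hp hx
    have h1 := (tendsto_cutoff_sqrt_div hp1 hn hxα).mul (ih (d := d - 1) hp1
      (hd.mono fun N hN => by push_cast; omega))
    have h2 := (tendsto_cutoff_sqrt_div hp hn hxα).mul (ih (d := d + 1) hp2 (by
      filter_upwards [hd, eventually_pos_of_tendsto_div hp hx] with N hN h0
      omega))
    simp only [pow_succ', entry_meanMatrix_mul]
    convert! h1.add h2 using 2
    rw [walkCount]
    ring

theorem tendsto_floor_mul_div {x : ℝ} (hx : 0 ≤ x) :
    Tendsto (fun N : ℕ => (⌊(N : ℝ) * x⌋₊ : ℝ) / N) atTop (𝓝 x) := by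
  simpa only [mul_comm x] using!
    (tendsto_nat_floor_mul_div_atTop hx).comp (tendsto_natCast_atTop_atTop (R := ℝ))

/-! ### The linear statistic -/

/-- Each off-diagonal variable occupies two symmetric positions and so collects two entries. Summing
up to N rather than n adds only zeros and gives all values of α a common index range. -/
theorem trace_noiseMatrix_mul {Ω : Type*} (Z : ℕ ⊕ ℕ → Ω → ℝ) {N n : ℕ} (hn : n ≤ N) (ω : Ω)
    (X : Matrix (Fin n) (Fin n) ℝ) :
    (noiseMatrix Z n ω * X).trace = ∑ p ∈ Finset.range N,
      (entry X p p * Z (.inl p) ω + (entry X (p + 1) p + entry X p (p + 1)) * Z (.inr p) ω) := by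
  have hext : ∑ p ∈ Finset.range N,
      (entry X p p * Z (.inl p) ω + (entry X (p + 1) p + entry X p (p + 1)) * Z (.inr p) ω) =
      ∑ p ∈ Finset.range n,
      (entry X p p * Z (.inl p) ω + (entry X (p + 1) p + entry X p (p + 1)) * Z (.inr p) ω) := by
    refine (Finset.sum_subset (Finset.range_subset_range.2 hn) fun p _ hp => ?_).symm
    have hp' : n ≤ p := by simpa using hp
    rw [entry_of_le_left X hp', entry_of_le_right X hp', entry_of_le_left X hp']
    simp
  rw [hext, trace_eq_sum_entry, noiseMatrix]
  simp only [entry_tridiag_mul (e := shiftRight fun p => Z (.inr p) ω) rfl, add_mul,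
    ← add_assoc]
  rw [Finset.sum_add_distrib, Finset.sum_add_distrib, Finset.sum_add_distrib,
    Finset.sum_add_distrib]
  congr 1
  · congr 1
    · refine Finset.sum_congr rfl fun p hp => ?_
      rw [cutoff, if_pos (Finset.mem_range.1 hp), mul_comm]
    · refine Finset.sum_congr rfl fun p hp => ?_
      by_cases h : p + 1 < n
      · rw [cutoff, if_pos h, mul_comm]
        rfl
      · rw [entry_of_le_left X (not_lt.1 h)]
        simp
  · rcases n with _ | n
    · simp
    -- Reindexing by one: the bottom term on the left vanishes because `shiftRight` starts with 0,
    -- and the top term on the right because its column is out of range.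
    rw [Finset.sum_range_succ', Finset.sum_range_succ, entry_of_le_right X le_rfl]
    congr 1
    · refine Finset.sum_congr rfl fun p hp => ?_
      rw [cutoff, if_pos (by simpa using hp), mul_comm, Nat.add_sub_cancel]
      rfl
    · simp [cutoff, shiftRight]

/-- The weight of the `m`-th diagonal noise variable in the linear statistic. -/
def diagWeight (n : ℕ → ℕ) (k N m : ℕ) : ℝ :=
  k * entry (meanMatrix N (n N) ^ (k - 1)) m m

/-- The weight of the `m`-th off-diagonal noise variable in the linear statistic. -/
def offDiagWeight (n : ℕ → ℕ) (k N m : ℕ) : ℝ :=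
  k * (entry (meanMatrix N (n N) ^ (k - 1)) (m + 1) m +
    entry (meanMatrix N (n N) ^ (k - 1)) m (m + 1))

/-- The limiting profile of `diagWeight`. -/
def diagProfile (α : ℝ) (k : ℕ) (x : ℝ) : ℝ :=
  if x < α then k * walkCount (k - 1) 0 * √x ^ (k - 1) else 0

/-- The limiting profile of `offDiagWeight`. -/
def offDiagProfile (α : ℝ) (k : ℕ) (x : ℝ) : ℝ :=
  if x < α then k * walkCount k 0 * √x ^ (k - 1) else 0

theorem trace_powLinear_eq {Ω : Type*} (Z : ℕ ⊕ ℕ → Ω → ℝ) {n : ℕ → ℕ} (hn : ∀ N, n N ≤ N)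
    (k N : ℕ) (ω : Ω) :
    (powLinear (meanMatrix N (n N)) (noiseMatrix Z (n N) ω) k).trace =
      ∑ m ∈ Finset.range N, (diagWeight n k N m * Z (.inl m) ω +
        offDiagWeight n k N m * Z (.inr m) ω) := by
  rw [trace_powLinear, trace_noiseMatrix_mul Z (hn N), Finset.mul_sum]
  refine Finset.sum_congr rfl fun m _ => ?_
  rw [diagWeight, offDiagWeight]
  ring

theorem abs_diagWeight_le {n : ℕ → ℕ} (hn : ∀ N, n N ≤ N) (k N m : ℕ) :
    |diagWeight n k N m| ≤ k * 2 ^ k := by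
  rw [diagWeight, abs_mul, Nat.abs_cast]
  exact mul_le_mul_of_nonneg_left ((abs_entry_meanMatrix_pow_le (hn N) _ _ _).trans
    (pow_le_pow_right₀ one_le_two (Nat.sub_le _ _))) (Nat.cast_nonneg _)

theorem abs_offDiagWeight_le {n : ℕ → ℕ} (hn : ∀ N, n N ≤ N) (k N m : ℕ) :
    |offDiagWeight n k N m| ≤ k * 2 ^ k := by
  rcases k with _ | k
  · simp [offDiagWeight]
  rw [offDiagWeight, abs_mul, Nat.abs_cast, pow_succ', two_mul]
  exact mul_le_mul_of_nonneg_left ((abs_add_le _ _).trans (add_le_add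
    (abs_entry_meanMatrix_pow_le (hn N) _ _ _) (abs_entry_meanMatrix_pow_le (hn N) _ _ _)))
    (Nat.cast_nonneg _)

theorem tendsto_diagWeight {n : ℕ → ℕ} {α : ℝ}
    (hn : Tendsto (fun N => (n N : ℝ) / N) atTop (𝓝 α)) (k : ℕ) {x : ℝ} (hx : 0 < x) (hxα : x ≠ α) :
    Tendsto (fun N : ℕ => diagWeight n k N ⌊(N : ℝ) * x⌋₊) atTop (𝓝 (diagProfile α k x)) := by
  have hp := tendsto_floor_mul_div hx.le
  rcases lt_or_gt_of_ne hxα with h | h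
  · rw [diagProfile, if_pos h]
    have := (tendsto_entry_meanMatrix_pow hx h hn (k - 1) (d := 0) hp
      (q := fun N => ⌊(N : ℝ) * x⌋₊) (by simp)).const_mul (k : ℝ)
    convert! this using 2
    ring
  · rw [diagProfile, if_neg h.not_gt]
    refine tendsto_const_nhds.congr' ?_
    filter_upwards [eventually_lt_of_tendsto_div hn hp h] with N hN
    rw [diagWeight, entry_of_le_left _ hN.le, mul_zero]

theorem tendsto_offDiagWeight {n : ℕ → ℕ} {α : ℝ}
    (hn : Tendsto (fun N => (n N : ℝ) / N) atTop (𝓝 α)) {k : ℕ} (hk : 1 ≤ k) {x : ℝ}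
    (hx : 0 < x) (hxα : x ≠ α) :
    Tendsto (fun N : ℕ => offDiagWeight n k N ⌊(N : ℝ) * x⌋₊) atTop
      (𝓝 (offDiagProfile α k x)) := by
  have hp := tendsto_floor_mul_div hx.le
  rcases lt_or_gt_of_ne hxα with h | h
  · rw [offDiagProfile, if_pos h]
    obtain ⟨k, rfl⟩ := Nat.exists_eq_add_of_le' hk
    -- The displacements are written 0 - 1 and 0 + 1 to match the recursion of `walkCount` at 0: the
    -- two walk numbers add up to that of closed walks with one more step.
    have h1 := tendsto_entry_meanMatrix_pow hx h hn k (d := 0 - 1)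
      (tendsto_natCast_add_one_div hp) (q := fun N => ⌊(N : ℝ) * x⌋₊) (by simp)
    have h2 := tendsto_entry_meanMatrix_pow hx h hn k (d := 0 + 1) hp
      (q := fun N => ⌊(N : ℝ) * x⌋₊ + 1) (by simp)
    convert! (h1.add h2).const_mul ((k + 1 : ℕ) : ℝ) using 2
    rw [walkCount, Nat.add_sub_cancel]
    ring
  · rw [offDiagProfile, if_neg h.not_gt]
    refine tendsto_const_nhds.congr' ?_
    filter_upwards [eventually_lt_of_tendsto_div hn hp h] with N hN
    rw [offDiagWeight, entry_of_le_left _ (hN.le.trans (Nat.le_succ _)),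
      entry_of_le_left _ hN.le, add_zero, mul_zero]

/-! ### The limiting covariance -/

theorem intervalIntegrable_ite_lt {f : ℝ → ℝ} (hf : Continuous f) (β : ℝ) :
    IntervalIntegrable (fun x => if x < β then f x else 0) volume 0 1 := by
  have : (fun x => if x < β then f x else 0) = (Set.Iio β).indicator f := by
    ext x; simp [Set.indicator_apply]
  rw [this, intervalIntegrable_iff]
  exact ((hf.intervalIntegrable 0 1).def').indicator measurableSet_Iio

/-- Applied with m = k + k' - 2, which yields the power (k + k')/2 and the factor 2/(k + k'). -/
theorem integral_ite_lt_sqrt_pow {β : ℝ} (hβ : β ∈ Set.Ioc (0 : ℝ) 1) (c : ℝ) (m : ℕ) :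
    ∫ x in (0 : ℝ)..1, (if x < β then c * √x ^ m else 0) =
      c * (β ^ (((m : ℝ) + 2) / 2) * (2 / (m + 2))) := by
  have h1 : (fun x => if x < β then c * √x ^ m else 0) =
      (Set.Iio β).indicator fun x => c * √x ^ m := by
    ext x; simp [Set.indicator_apply]
  have h2 : Set.Ioc (0 : ℝ) 1 ∩ Set.Iio β = Set.Ioo 0 β := by
    ext x
    simp only [Set.mem_inter_iff, Set.mem_Ioc, Set.mem_Iio, Set.mem_Ioo]
    exact ⟨fun h => ⟨h.1.1, h.2⟩, fun h => ⟨⟨h.1, h.2.le.trans hβ.2⟩, h.2⟩⟩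
  rw [intervalIntegral.integral_of_le zero_le_one, h1,
    setIntegral_indicator measurableSet_Iio, h2, ← integral_Ioc_eq_integral_Ioo,
    ← intervalIntegral.integral_of_le hβ.1.le, intervalIntegral.integral_const_mul]
  congr 1
  have h3 : ∀ x ∈ Set.uIcc (0 : ℝ) β, √x ^ m = x ^ ((m : ℝ) / 2) := by
    intro x hx
    rw [Set.uIcc_of_le hβ.1.le] at hx
    rw [Real.sqrt_eq_rpow, ← Real.rpow_natCast, ← Real.rpow_mul hx.1]
    congr 1
    ring
  have hm : (0 : ℝ) ≤ (m : ℝ) / 2 := by positivity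
  rw [intervalIntegral.integral_congr h3, integral_rpow (Or.inl (by linarith)),
    Real.zero_rpow (by positivity), show (m : ℝ) / 2 + 1 = ((m : ℝ) + 2) / 2 by ring]
  field_simp
  ring

theorem mul_ite_lt (α α' x f g : ℝ) :
    (if x < α then f else 0) * (if x < α' then g else 0) =
      if x < min α α' then f * g else 0 := by
  by_cases h : x < α <;> by_cases h' : x < α' <;> simp [h, h']

/-- The integrand whose integral over `(0, 1)` is the limiting covariance. -/
def covarianceDensity (sa sξ α α' : ℝ) (k k' : ℕ) (x : ℝ) : ℝ :=
  diagProfile α k x * diagProfile α' k' x * sa ^ 2 +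
    offDiagProfile α k x * offDiagProfile α' k' x * sξ ^ 2

theorem covarianceDensity_eq (sa sξ α α' : ℝ) (k k' : ℕ) (x : ℝ) :
    covarianceDensity sa sξ α α' k k' x = if x < min α α' then
      (k * k' * (walkCount (k - 1) 0 * walkCount (k' - 1) 0 * sa ^ 2 +
        walkCount k 0 * walkCount k' 0 * sξ ^ 2)) * √x ^ (k - 1 + (k' - 1)) else 0 := by
  simp only [covarianceDensity, diagProfile, offDiagProfile, mul_ite_lt]
  split_ifs
  · rw [pow_add]; ring
  · simp

theorem intervalIntegrable_covarianceDensity (sa sξ α α' : ℝ) (k k' : ℕ) :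
    IntervalIntegrable (covarianceDensity sa sξ α α' k k') volume 0 1 := by
  have := intervalIntegrable_ite_lt (f := fun x =>
    (k * k' * (walkCount (k - 1) 0 * walkCount (k' - 1) 0 * sa ^ 2 +
        walkCount k 0 * walkCount k' 0 * sξ ^ 2)) * √x ^ (k - 1 + (k' - 1)))
    (by fun_prop) (min α α')
  simpa only [← covarianceDensity_eq] using this

/-- Closed walks of odd length do not exist. The diagonal part needs k - 1 and k' - 1 even, the
off-diagonal part k and k' even; mixed parity kills both. -/
theorem integral_covarianceDensity (sa sξ : ℝ) {α α' : ℝ} (hα : α ∈ Set.Ioc (0 : ℝ) 1)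
    (hα' : α' ∈ Set.Ioc (0 : ℝ) 1) {k k' : ℕ} (hk : 1 ≤ k) (hk' : 1 ≤ k') :
    ∫ x in (0 : ℝ)..1, covarianceDensity sa sξ α α' k k' x = limitCovariance sa sξ α α' k k' := by
  simp only [covarianceDensity_eq]
  rw [integral_ite_lt_sqrt_pow ⟨lt_min hα.1 hα'.1, (min_le_left _ _).trans hα.2⟩,
    limitCovariance]
  have hm : ((k - 1 + (k' - 1) : ℕ) : ℝ) + 2 = k + k' := by
    rw [Nat.cast_add, Nat.cast_sub hk, Nat.cast_sub hk']
    push_cast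
    ring
  rw [hm]
  have hodd : ∀ {j : ℕ}, 1 ≤ j → Odd j → Even (j - 1) := fun h h' => by
    obtain ⟨m, rfl⟩ := h'; simp
  have heven : ∀ {j : ℕ}, 1 ≤ j → Even j → Odd (j - 1) := fun h h' => by
    obtain ⟨m, rfl⟩ := h'; exact ⟨m - 1, by omega⟩
  rcases Nat.even_or_odd k with h | h <;> rcases Nat.even_or_odd k' with h' | h'
  · have h1 : ¬(Odd k ∧ Odd k') := fun hc => (Nat.not_odd_iff_even.2 h) hc.1
    rw [if_neg h1, if_pos ⟨h, h'⟩, walkCount_zero_of_odd (heven hk h), walkCount_zero_of_even h,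
      walkCount_zero_of_even h']
    ring
  · have h1 : ¬(Odd k ∧ Odd k') := fun hc => (Nat.not_odd_iff_even.2 h) hc.1
    have h2 : ¬(Even k ∧ Even k') := fun hc => (Nat.not_even_iff_odd.2 h') hc.2
    rw [if_neg h1, if_neg h2, walkCount_zero_of_odd (heven hk h), walkCount_zero_of_odd h']
    ring
  · have h1 : ¬(Odd k ∧ Odd k') := fun hc => (Nat.not_odd_iff_even.2 h') hc.2
    have h2 : ¬(Even k ∧ Even k') := fun hc => (Nat.not_even_iff_odd.2 h) hc.1
    rw [if_neg h1, if_neg h2, walkCount_zero_of_odd (heven hk' h'), walkCount_zero_of_odd h]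
    ring
  · rw [if_pos ⟨h, h'⟩, walkCount_zero_of_even (hodd hk h), walkCount_zero_of_even (hodd hk' h'),
      walkCount_zero_of_odd h]
    ring

/-! ### Convergence of random vectors to a Gaussian vector -/

/-- Cramér–Wold device with a Gaussian limit of prescribed covariance matrix. -/
theorem exists_gaussian_tendstoInDistribution {Ω : Type*} [MeasurableSpace Ω] {P : Measure Ω}
    [IsProbabilityMeasure P] {ι : Type*} [Fintype ι] {X : ℕ → Ω → ι → ℝ}
    (hX : ∀ N, Measurable (X N)) {S : Matrix ι ι ℝ} (hS : S.PosSemidef)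
    (h : ∀ t : ι → ℝ, Tendsto (fun N => charFun (P.map fun ω => ∑ i, t i * X N ω i) 1) atTop
      (𝓝 (Complex.exp (-((t ⬝ᵥ S.mulVec t : ℝ) / 2 : ℂ))))) :
    ∃ (γ : Measure (ι → ℝ)) (_ : IsGaussian γ), (∀ i, ∫ x, x i ∂γ = 0) ∧
      (∀ i j, covariance (fun x => x i) (fun x => x j) γ = S i j) ∧
      TendstoInDistribution X atTop (id : (ι → ℝ) → ι → ℝ) (fun _ => P) γ := by
  classical
  -- Characteristic functions use an inner product, so convergence is proved in `EuclideanSpace ℝ ι`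
  -- and then transported along L.
  set ν := multivariateGaussian (0 : EuclideanSpace ℝ ι) S with hν
  set L := PiLp.continuousLinearEquiv 2 ℝ (fun _ : ι => ℝ) with hL
  have hLapp : ∀ x i, L x i = x i := fun x i => rfl
  have hLm : Measurable L := L.continuous.measurable
  have hev : ∀ i, AEStronglyMeasurable (fun x : ι → ℝ => x i) (ν.map L) := fun i =>
    (measurable_pi_apply i).aestronglyMeasurable
  have hlim : TendstoInDistribution (fun N ω => WithLp.toLp 2 (X N ω)) atTop
      (id : EuclideanSpace ℝ ι → _) (fun _ => P) ν := by
    have hXm : ∀ N, Measurable fun ω => WithLp.toLp 2 (X N ω) := fun N =>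
      (WithLp.measurable_toLp 2 _).comp (hX N)
    refine ⟨fun N => (hXm N).aemeasurable, aemeasurable_id,
      ProbabilityMeasure.tendsto_of_tendsto_charFun fun t => ?_⟩
    simp only [ProbabilityMeasure.coe_mk, Measure.map_id]
    rw [hν, charFun_multivariateGaussian hS]
    convert! h t using 2 with N
    · have hm : Measurable fun ω => ∑ i, t i * X N ω i :=
        Finset.measurable_sum _ fun i _ => ((measurable_pi_apply i).comp (hX N)).const_mul _
      rw [charFun_map_eq_integral hm, charFun_apply,
        integral_map (hXm N).aemeasurable (by fun_prop)]
      simp [PiLp.inner_apply]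
    · simp
  refine ⟨ν.map L, inferInstance, fun i => ?_, fun i j => ?_, ?_⟩
  · rw [integral_map hLm.aemeasurable (hev i)]
    have := (EuclideanSpace.proj (𝕜 := ℝ) i).integral_comp_comm
      (IsGaussian.integrable_id (μ := ν))
    simp only [id, hν, integral_id_multivariateGaussian] at this
    simpa [hLapp] using this
  · rw [covariance_map_fun (hev i) (hev j) hLm.aemeasurable]
    exact covariance_eval_multivariateGaussian hS i j
  · have h2 := hlim.continuous_comp L.continuous
    refine ⟨fun N => (hX N).aemeasurable, aemeasurable_id, ?_⟩
    convert! h2.tendsto using 2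
    simp

/-! ### The scaled traces -/

section Main

variable {Ω : Type*}

/-- All noise variables as one family indexed by sites: diagonal ones first. -/
def noiseFamily (a ξ : ℕ+ → Ω → ℝ) : ℕ ⊕ ℕ → Ω → ℝ :=
  Sum.elim (fun p => a p.succPNat) fun p => ξ p.succPNat

/-- Site p stands for m = p + 1. The coupling of p and p + 1 is √(p + 1) plus the ξ-variable of site
p, which accounts for the shift in `noiseMatrix`. -/
theorem inv_sqrt_smul_tridiagonalMatrix (a ξ : ℕ+ → Ω → ℝ) (N n : ℕ) (ω : Ω) :
    (√(N : ℝ))⁻¹ • tridiagonalMatrix a ξ n ω =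
      meanMatrix N n + (√(N : ℝ))⁻¹ • noiseMatrix (noiseFamily a ξ) n ω := by
  ext i j
  simp only [tridiagonalMatrix, meanMatrix, noiseMatrix, tridiag, Matrix.smul_apply,
    Matrix.add_apply, Matrix.of_apply, smul_eq_mul, Nat.succPNat_coe]
  split_ifs with h1 h2 h3
  · simp [noiseFamily]
  · rw [← h2]
    simp only [shiftRight, noiseFamily, Sum.elim_inr]
    push_cast
    ring
  · rw [← h3]
    simp only [shiftRight, noiseFamily, Sum.elim_inr]
    push_cast
    ring
  · simp

theorem scaledTrace_eq_trace_pow (a ξ : ℕ+ → Ω → ℝ) (α : ℝ) (k N : ℕ) (ω : Ω) :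
    scaledTrace a ξ α k N ω = ((meanMatrix N ⌊α * N⌋₊ +
      (√(N : ℝ))⁻¹ • noiseMatrix (noiseFamily a ξ) ⌊α * N⌋₊ ω) ^ k).trace := by
  rw [scaledTrace, inv_sqrt_smul_tridiagonalMatrix]

theorem floor_mul_le {α : ℝ} (hα : α ≤ 1) (N : ℕ) : ⌊α * N⌋₊ ≤ N :=
  Nat.floor_le_of_le (mul_le_of_le_one_left (Nat.cast_nonneg N) hα)

/-- The quadratic remainder in the expansion of the scaled trace. -/
def traceRem (a ξ : ℕ+ → Ω → ℝ) (α : ℝ) (k N : ℕ) (ω : Ω) : ℝ :=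
  ((√(N : ℝ))⁻¹) ^ 2 * (powRem (meanMatrix N ⌊α * N⌋₊)
    (noiseMatrix (noiseFamily a ξ) ⌊α * N⌋₊ ω) (√(N : ℝ))⁻¹ k).trace

/-- The linear statistic of a noise family in the expansion of the scaled trace. -/
def linearStat (Z : ℕ ⊕ ℕ → Ω → ℝ) (α : ℝ) (k N : ℕ) (ω : Ω) : ℝ :=
  (√(N : ℝ))⁻¹ * ∑ m ∈ Finset.range N,
    (diagWeight (fun N => ⌊α * N⌋₊) k N m * Z (.inl m) ω +
      offDiagWeight (fun N => ⌊α * N⌋₊) k N m * Z (.inr m) ω)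

theorem scaledTrace_eq (a ξ : ℕ+ → Ω → ℝ) {α : ℝ} (hα : α ≤ 1) (k N : ℕ) (ω : Ω) :
    scaledTrace a ξ α k N ω = (meanMatrix N ⌊α * N⌋₊ ^ k).trace +
      linearStat (noiseFamily a ξ) α k N ω + traceRem a ξ α k N ω := by
  rw [scaledTrace_eq_trace_pow, add_smul_pow_eq, Matrix.trace_add, Matrix.trace_add,
    Matrix.trace_smul, Matrix.trace_smul, smul_eq_mul, smul_eq_mul,
    trace_powLinear_eq (noiseFamily a ξ) (n := fun N => ⌊α * N⌋₊) (floor_mul_le hα)]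
  rfl

variable [MeasurableSpace Ω] {P : Measure Ω} {a ξ : ℕ+ → Ω → ℝ}

theorem integral_linearStat {Z : ℕ ⊕ ℕ → Ω → ℝ} (hZ : ∀ j, Integrable (Z j) P) (α : ℝ)
    (k N : ℕ) : Integrable (linearStat Z α k N) P ∧
      ∫ ω, linearStat Z α k N ω ∂P = (√(N : ℝ))⁻¹ * ∑ m ∈ Finset.range N,
        (diagWeight (fun N => ⌊α * N⌋₊) k N m * ∫ ω, Z (.inl m) ω ∂P +
          offDiagWeight (fun N => ⌊α * N⌋₊) k N m * ∫ ω, Z (.inr m) ω ∂P) := by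
  have h : ∀ m, Integrable (fun ω => diagWeight (fun N => ⌊α * N⌋₊) k N m * Z (.inl m) ω +
      offDiagWeight (fun N => ⌊α * N⌋₊) k N m * Z (.inr m) ω) P := fun m =>
    ((hZ (.inl m)).const_mul _).add ((hZ (.inr m)).const_mul _)
  refine ⟨(integrable_finsetSum _ fun m _ => h m).const_mul _, ?_⟩
  simp only [linearStat]
  rw [integral_const_mul, integral_finsetSum _ fun m _ => h m]
  congr 1
  refine Finset.sum_congr rfl fun m _ => ?_
  rw [integral_add ((hZ _).const_mul _) ((hZ _).const_mul _), integral_const_mul,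
    integral_const_mul]

theorem linearStat_sub_integral {Z : ℕ ⊕ ℕ → Ω → ℝ} (hZ : ∀ j, Integrable (Z j) P) (α : ℝ)
    (k N : ℕ) (ω : Ω) :
    linearStat Z α k N ω - ∫ ω', linearStat Z α k N ω' ∂P =
      linearStat (fun j ω => Z j ω - ∫ ω', Z j ω' ∂P) α k N ω := by
  rw [(integral_linearStat hZ α k N).2, linearStat, linearStat, ← mul_sub,
    ← Finset.sum_sub_distrib]
  congr 1
  refine Finset.sum_congr rfl fun m _ => ?_
  ring

theorem momentBounded_noiseFamily (ha_meas : ∀ m, Measurable (a m))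
    (hξ_meas : ∀ m, Measurable (ξ m))
    (ha_mom : ∀ k : ℕ, ∃ C : ℝ, ∀ m,
      Integrable (fun ω => |a m ω| ^ k) P ∧ ∫ ω, |a m ω| ^ k ∂P ≤ C)
    (hξ_mom : ∀ k : ℕ, ∃ C : ℝ, ∀ m,
      Integrable (fun ω => |ξ m ω| ^ k) P ∧ ∫ ω, |ξ m ω| ^ k ∂P ≤ C) :
    MomentBounded P (noiseFamily a ξ) where
  measurable := by
    rintro (p | p)
    · exact ha_meas _
    · exact hξ_meas _
  bound k := by
    obtain ⟨C, hC⟩ := ha_mom k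
    obtain ⟨D, hD⟩ := hξ_mom k
    refine ⟨max C D, ?_⟩
    rintro (p | p)
    · exact ⟨(hC _).1, (hC _).2.trans (le_max_left _ _)⟩
    · exact ⟨(hD _).1, (hD _).2.trans (le_max_right _ _)⟩

theorem iIndepFun_noiseFamily (h : iIndepFun (Sum.elim a ξ : ℕ+ ⊕ ℕ+ → Ω → ℝ) P) :
    iIndepFun (noiseFamily a ξ) P := by
  have hinj : Function.Injective (Sum.map Nat.succPNat Nat.succPNat) :=
    Nat.succPNat_injective.sumMap Nat.succPNat_injective
  have := h.precomp hinj
  convert! this using 1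
  ext (p | p) ω <;> rfl

variable [IsProbabilityMeasure P]

theorem memLp_traceRem (hZ : MomentBounded P (noiseFamily a ξ)) {α : ℝ} (hα : α ≤ 1) (k N : ℕ) :
    MemLp (traceRem a ξ α k N) 2 P :=
  ((localBounded_powRem hZ (n := fun N => ⌊α * N⌋₊) (floor_mul_le hα) k).memLp_trace N).const_mul _

theorem measurable_traceRem (hZ : MomentBounded P (noiseFamily a ξ)) {α : ℝ} (hα : α ≤ 1)
    (k N : ℕ) : Measurable (traceRem a ξ α k N) :=
  ((localBounded_powRem hZ (n := fun N => ⌊α * N⌋₊)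
    (floor_mul_le hα) k).measurable_trace N).const_mul _

theorem measurable_scaledTrace (hZ : MomentBounded P (noiseFamily a ξ)) {α : ℝ} (hα : α ≤ 1)
    (k N : ℕ) : Measurable (scaledTrace a ξ α k N) := by
  simp only [funext fun ω => scaledTrace_eq_trace_pow a ξ α k N ω]
  exact (localBounded_pow hZ (n := fun N => ⌊α * N⌋₊) (floor_mul_le hα) k).measurable_trace N

theorem integrable_scaledTrace (hZ : MomentBounded P (noiseFamily a ξ)) {α : ℝ} (hα : α ≤ 1)
    (k N : ℕ) : Integrable (scaledTrace a ξ α k N) P := by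
  rw [funext fun ω => scaledTrace_eq_trace_pow a ξ α k N ω]
  exact ((localBounded_pow hZ (n := fun N => ⌊α * N⌋₊) (floor_mul_le hα) k).memLp_trace
    N).integrable one_le_two

/-- The deterministic trace cancels, and by linearity the centering passes to the noise in the
linear term. The remainder keeps the uncentered noise, since only its variance matters. -/
theorem scaledTrace_sub_integral (hZ : MomentBounded P (noiseFamily a ξ)) {α : ℝ} (hα : α ≤ 1)
    (k N : ℕ) (ω : Ω) :
    scaledTrace a ξ α k N ω - ∫ ω', scaledTrace a ξ α k N ω' ∂P =
      linearStat (fun j ω => noiseFamily a ξ j ω - ∫ ω', noiseFamily a ξ j ω' ∂P) α k N ω +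
        (traceRem a ξ α k N ω - ∫ ω', traceRem a ξ α k N ω' ∂P) := by
  have hl := (integral_linearStat (fun j => hZ.integrable j) α k N).1
  have hr : Integrable (traceRem a ξ α k N) P := (memLp_traceRem hZ hα k N).integrable one_le_two
  rw [← linearStat_sub_integral fun j => hZ.integrable j]
  simp only [scaledTrace_eq a ξ hα]
  have hcl : Integrable (fun ω => (meanMatrix N ⌊α * N⌋₊ ^ k).trace +
      linearStat (noiseFamily a ξ) α k N ω) P := (integrable_const _).add hl
  rw [integral_add hcl hr, integral_add (integrable_const _) hl]
  simp only [integral_const, probReal_univ, one_smul]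
  ring

/-- This is Var |Y| ≥ 0. -/
theorem integral_abs_le_sqrt_integral_sq {Y : Ω → ℝ} (hY : MemLp Y 2 P) :
    ∫ ω, |Y ω| ∂P ≤ √(∫ ω, Y ω ^ 2 ∂P) := by
  refine Real.le_sqrt_of_sq_le ?_
  have h := variance_nonneg (fun ω => |Y ω|) P
  rw [variance_eq_sub (show MemLp (fun ω => |Y ω|) 2 P from hY.abs)] at h
  simpa [sub_nonneg] using h

/-- The prefactor 1/N enters the variance squared against a trace variance of order N, so the L¹
norm is O(N^{-1/2}). -/
theorem tendsto_integral_abs_traceRem_sub (hZ : MomentBounded P (noiseFamily a ξ))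
    (hind : iIndepFun (noiseFamily a ξ) P) {α : ℝ} (hα : α ≤ 1) (k : ℕ) :
    Tendsto (fun N => ∫ ω, |traceRem a ξ α k N ω - ∫ ω', traceRem a ξ α k N ω' ∂P| ∂P) atTop
      (𝓝 0) := by
  obtain ⟨C, hC⟩ := (localBounded_powRem hZ (n := fun N => ⌊α * N⌋₊)
    (floor_mul_le hα) k).variance_trace_le hZ.measurable hind
  have hlim : Tendsto (fun N : ℕ => √((N : ℝ)⁻¹ * |C|)) atTop (𝓝 0) := by
    have := (tendsto_inv_atTop_nhds_zero_nat (𝕜 := ℝ)).mul_const |C|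
    rw [zero_mul] at this
    simpa using this.sqrt
  refine squeeze_zero (fun N => integral_nonneg fun ω => abs_nonneg _) (fun N => ?_) hlim
  have hm := memLp_traceRem hZ hα k N
  refine (integral_abs_le_sqrt_integral_sq (hm.sub (memLp_const _))).trans
    (Real.sqrt_le_sqrt ?_)
  simp only [Pi.sub_apply]
  rw [← variance_eq_integral hm.aemeasurable]
  have hv : variance (traceRem a ξ α k N) P = (((√(N : ℝ))⁻¹) ^ 2) ^ 2 *
      variance (fun ω => (powRem (meanMatrix N ⌊α * N⌋₊)
        (noiseMatrix (noiseFamily a ξ) ⌊α * N⌋₊ ω) (√(N : ℝ))⁻¹ k).trace) P :=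
    variance_const_mul _ _ _
  rw [hv, inv_pow, Real.sq_sqrt (Nat.cast_nonneg N)]
  have h1 : variance (fun ω => (powRem (meanMatrix N ⌊α * N⌋₊)
      (noiseMatrix (noiseFamily a ξ) ⌊α * N⌋₊ ω) (√(N : ℝ))⁻¹ k).trace) P ≤ N * |C| :=
    (hC N).trans ((mul_le_mul_of_nonneg_left (le_abs_self C) (Nat.cast_nonneg _)).trans
      (mul_le_mul_of_nonneg_right (by exact_mod_cast floor_mul_le hα N) (abs_nonneg C)))
  refine (mul_le_mul_of_nonneg_left h1 (by positivity)).trans (le_of_eq ?_)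
  rcases Nat.eq_zero_or_pos N with rfl | hN
  · simp
  · have : (N : ℝ) ≠ 0 := by positivity
    field_simp

/-- A vanishing mean does not affect the limit of the second moments. -/
theorem tendsto_integral_center_sq {Y : ℕ+ → Ω → ℝ} (hY : ∀ m, MemLp (Y m) 2 P) {μ s : ℝ}
    (hmean : Tendsto (fun m : ℕ+ => √((m : ℕ) : ℝ) * ∫ ω, Y m ω ∂P) atTop (𝓝 μ))
    (hvar : Tendsto (fun m : ℕ+ => ∫ ω, Y m ω ^ 2 ∂P) atTop (𝓝 s)) :
    Tendsto (fun p : ℕ => ∫ ω, (Y p.succPNat ω - ∫ ω', Y p.succPNat ω' ∂P) ^ 2 ∂P) atTop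
      (𝓝 s) := by
  have hsucc : Tendsto Nat.succPNat atTop atTop :=
    tendsto_atTop_atTop.2 fun b => ⟨b, fun p hp => PNat.coe_le_coe _ _ |>.1
      (hp.trans (by simp))⟩
  have hinv : Tendsto (fun p : ℕ => (√((p.succPNat : ℕ) : ℝ))⁻¹) atTop (𝓝 0) := by
    refine tendsto_inv_atTop_zero.comp (Real.tendsto_sqrt_atTop.comp
      (tendsto_natCast_atTop_atTop.comp ?_))
    simpa using tendsto_add_atTop_nat 1
  have hm0 : Tendsto (fun p : ℕ => ∫ ω, Y p.succPNat ω ∂P) atTop (𝓝 0) := by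
    have := hinv.mul (hmean.comp hsucc)
    rw [zero_mul] at this
    refine this.congr fun p => ?_
    have hp : √((p.succPNat : ℕ) : ℝ) ≠ 0 := by
      rw [Nat.succPNat_coe]
      positivity
    rw [Function.comp_apply, inv_mul_cancel_left₀ hp]
  have hlim := (hvar.comp hsucc).sub (hm0.pow 2)
  rw [zero_pow two_ne_zero, sub_zero] at hlim
  refine hlim.congr fun p => ?_
  rw [← variance_eq_integral (hY _).aemeasurable, variance_eq_sub (hY _)]
  rfl

end Main

/-! ### Linear combinations of traces and the limiting quadratic form -/

section Combination

variable {ι : Type*} [Fintype ι] (sa sξ : ℝ) (α : ι → ℝ) (k : ι → ℕ) (t : ι → ℝ)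

theorem sq_sum_profile_eq (x : ℝ) :
    (∑ i, t i * diagProfile (α i) (k i) x) ^ 2 * sa ^ 2 +
      (∑ i, t i * offDiagProfile (α i) (k i) x) ^ 2 * sξ ^ 2 =
    ∑ i, ∑ j, t i * (t j * covarianceDensity sa sξ (α i) (α j) (k i) (k j) x) := by
  rw [sq (∑ i, t i * diagProfile (α i) (k i) x), sq (∑ i, t i * offDiagProfile (α i) (k i) x),
    Finset.sum_mul_sum, Finset.sum_mul_sum]
  simp only [Finset.sum_mul, ← Finset.sum_add_distrib, covarianceDensity]
  refine Finset.sum_congr rfl fun i _ => Finset.sum_congr rfl fun j _ => ?_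
  ring

theorem integral_sq_sum_profile (hα : ∀ i, α i ∈ Set.Ioc (0 : ℝ) 1) (hk : ∀ i, 1 ≤ k i) :
    ∫ x in (0 : ℝ)..1, ((∑ i, t i * diagProfile (α i) (k i) x) ^ 2 * sa ^ 2 +
      (∑ i, t i * offDiagProfile (α i) (k i) x) ^ 2 * sξ ^ 2) =
    t ⬝ᵥ (Matrix.of fun i j => limitCovariance sa sξ (α i) (α j) (k i) (k j)).mulVec t := by
  have hi : ∀ i j, IntervalIntegrable (fun x => t i *
      (t j * covarianceDensity sa sξ (α i) (α j) (k i) (k j) x)) volume 0 1 := fun i j =>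
    ((intervalIntegrable_covarianceDensity sa sξ (α i) (α j) (k i) (k j)).const_mul _).const_mul _
  simp only [sq_sum_profile_eq]
  rw [intervalIntegral.integral_finsetSum fun i _ => by
    simpa only [Finset.sum_fn] using IntervalIntegrable.sum _ fun j _ => hi i j]
  simp only [dotProduct, Matrix.mulVec, Matrix.of_apply, Finset.mul_sum]
  refine Finset.sum_congr rfl fun i _ => ?_
  rw [intervalIntegral.integral_finsetSum fun j _ => hi i j]
  refine Finset.sum_congr rfl fun j _ => ?_
  rw [intervalIntegral.integral_const_mul, intervalIntegral.integral_const_mul,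
    integral_covarianceDensity sa sξ (hα i) (hα j) (hk i) (hk j)]
  ring

/-- The matrix is a Gram matrix of profiles: its quadratic form is an integral of sums of squares.
-/
theorem posSemidef_limitCovariance (hα : ∀ i, α i ∈ Set.Ioc (0 : ℝ) 1) (hk : ∀ i, 1 ≤ k i) :
    (Matrix.of fun i j => limitCovariance sa sξ (α i) (α j) (k i) (k j)).PosSemidef := by
  refine .of_dotProduct_mulVec_nonneg ?_ fun t => ?_
  · ext i j
    simp only [Matrix.conjTranspose_apply, Matrix.of_apply, star_trivial]
    rw [← integral_covarianceDensity sa sξ (hα j) (hα i) (hk j) (hk i),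
      ← integral_covarianceDensity sa sξ (hα i) (hα j) (hk i) (hk j)]
    congr 1
    ext x
    simp only [covarianceDensity]
    ring
  · rw [star_trivial, ← integral_sq_sum_profile sa sξ α k t hα hk]
    exact intervalIntegral.integral_nonneg zero_le_one fun x _ => by positivity

/-- A linear combination of linear statistics is again a single weighted sum, with combined weights
and profiles, so the scalar theorem applies. The jump points x = α i form a null set. -/
theorem tendsto_charFun_sum_linearStat {Ω : Type*} [MeasurableSpace Ω] {P : Measure Ω}
    [IsProbabilityMeasure P] {Z : ℕ ⊕ ℕ → Ω → ℝ} (hZ : MomentBounded P Z)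
    (hind : iIndepFun Z P) (h0 : ∀ j, ∫ ω, Z j ω ∂P = 0)
    (hv : Tendsto (fun m => ∫ ω, Z (.inl m) ω ^ 2 ∂P) atTop (𝓝 (sa ^ 2)))
    (hv' : Tendsto (fun m => ∫ ω, Z (.inr m) ω ^ 2 ∂P) atTop (𝓝 (sξ ^ 2)))
    (hα : ∀ i, α i ∈ Set.Ioc (0 : ℝ) 1) (hk : ∀ i, 1 ≤ k i) :
    Tendsto (fun N => charFun (P.map fun ω => ∑ i, t i * linearStat Z (α i) (k i) N ω) 1) atTop
      (𝓝 (Complex.exp (-((t ⬝ᵥ (Matrix.of fun i j =>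
        limitCovariance sa sξ (α i) (α j) (k i) (k j)).mulVec t : ℝ) / 2 : ℂ)))) := by
  have hn : ∀ i, Tendsto (fun N : ℕ => (⌊α i * N⌋₊ : ℝ) / N) atTop (𝓝 (α i)) := fun i =>
    by simpa only [mul_comm] using tendsto_floor_mul_div (hα i).1.le
  have hne : ∀ᵐ x : ℝ, ∀ i, x ≠ α i :=
    ae_all_iff.2 fun i => measure_eq_zero_iff_ae_notMem.1 (Real.volume_singleton (a := α i))
  have hbd : ∀ f : ι → ℝ, (∀ i, |f i| ≤ k i * 2 ^ k i) →
      |∑ i, t i * f i| ≤ ∑ i, |t i| * (k i * 2 ^ k i) := fun f hf =>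
    (Finset.abs_sum_le_sum_abs _ _).trans (Finset.sum_le_sum fun i _ => by
      rw [abs_mul]
      exact mul_le_mul_of_nonneg_left (hf i) (abs_nonneg _))
  have key := tendsto_charFun_weighted_sum hZ hind h0 hv hv'
    (u := fun N m => ∑ i, t i * diagWeight (fun N => ⌊α i * N⌋₊) (k i) N m)
    (w := fun N m => ∑ i, t i * offDiagWeight (fun N => ⌊α i * N⌋₊) (k i) N m)
    (U := fun x => ∑ i, t i * diagProfile (α i) (k i) x)
    (W := fun x => ∑ i, t i * offDiagProfile (α i) (k i) x)
    (fun N m => hbd _ fun i => abs_diagWeight_le (floor_mul_le (hα i).2) _ _ _)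
    (fun N m => hbd _ fun i => abs_offDiagWeight_le (floor_mul_le (hα i).2) _ _ _)
    (hne.mono fun x hx hx01 => tendsto_finsetSum _ fun i _ =>
      (tendsto_diagWeight (hn i) (k i) hx01.1 (hx i)).const_mul _)
    (hne.mono fun x hx hx01 => tendsto_finsetSum _ fun i _ =>
      (tendsto_offDiagWeight (hn i) (hk i) hx01.1 (hx i)).const_mul _)
  rw [integral_sq_sum_profile sa sξ α k t hα hk] at key
  refine key.congr fun N => ?_
  congr 2
  ext ω
  simp only [linearStat, Finset.sum_mul, ← Finset.sum_add_distrib, Finset.mul_sum]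
  rw [Finset.sum_comm]
  refine Finset.sum_congr rfl fun i _ => Finset.sum_congr rfl fun m _ => ?_
  ring

end Combination

end

theorem theoremA3 {Ω : Type*} [MeasurableSpace Ω] (P : Measure Ω) [IsProbabilityMeasure P]
    (a ξ : ℕ+ → Ω → ℝ)
    (ha_meas : ∀ m, Measurable (a m)) (hξ_meas : ∀ m, Measurable (ξ m))
    -- the variables `a 1, a 2, …, ξ 1, ξ 2, …` are mutually independent
    (h_indep : iIndepFun (Sum.elim a ξ : ℕ+ ⊕ ℕ+ → Ω → ℝ) P)
    -- all absolute moments are finite and bounded uniformly in `m`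
    (ha_mom : ∀ k : ℕ, ∃ C : ℝ, ∀ m,
      Integrable (fun ω => |a m ω| ^ k) P ∧ ∫ ω, |a m ω| ^ k ∂P ≤ C)
    (hξ_mom : ∀ k : ℕ, ∃ C : ℝ, ∀ m,
      Integrable (fun ω => |ξ m ω| ^ k) P ∧ ∫ ω, |ξ m ω| ^ k ∂P ≤ C)
    (μa μξ : ℝ)
    (ha_mean : Tendsto (fun m : ℕ+ => √((m : ℕ) : ℝ) * ∫ ω, a m ω ∂P) atTop (𝓝 μa))
    (hξ_mean : Tendsto (fun m : ℕ+ => √((m : ℕ) : ℝ) * ∫ ω, ξ m ω ∂P) atTop (𝓝 μξ))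
    (sa sξ : ℝ) (hsa : 0 < sa) (hsξ : 0 < sξ)
    (ha_var : Tendsto (fun m : ℕ+ => ∫ ω, a m ω ^ 2 ∂P) atTop (𝓝 (sa ^ 2)))
    (hξ_var : Tendsto (fun m : ℕ+ => ∫ ω, ξ m ω ^ 2 ∂P) atTop (𝓝 (sξ ^ 2)))
    -- a finite family of parameters `α ∈ (0, 1]`, `k ∈ {1, 2, …}`
    {ι : Type*} [Fintype ι] (α : ι → ℝ) (k : ι → ℕ)
    (hα : ∀ i, α i ∈ Set.Ioc (0 : ℝ) 1) (hk : ∀ i, 1 ≤ k i) :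
    (∀ i (N : ℕ), Integrable (scaledTrace a ξ (α i) (k i) N) P) ∧
    ∃ (γ : Measure (ι → ℝ)) (_ : IsGaussian γ),
      (∀ i, ∫ x, x i ∂γ = 0) ∧
      (∀ i j, covariance (fun x => x i) (fun x => x j) γ =
        limitCovariance sa sξ (α i) (α j) (k i) (k j)) ∧
      TendstoInDistribution
        (fun (N : ℕ) ω i => scaledTrace a ξ (α i) (k i) N ω -
          ∫ ω', scaledTrace a ξ (α i) (k i) N ω' ∂P)
        atTop (id : (ι → ℝ) → ι → ℝ) (fun _ => P) γ := by
  
  have hZ := momentBounded_noiseFamily ha_meas hξ_meas ha_mom hξ_mom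
  have hind := iIndepFun_noiseFamily h_indep
  refine ⟨fun i N => integrable_scaledTrace hZ (hα i).2 _ _, ?_⟩
  set Z : ℕ ⊕ ℕ → Ω → ℝ := fun j ω =>
    noiseFamily a ξ j ω - ∫ ω', noiseFamily a ξ j ω' ∂P with hZdef
  have hZc : MomentBounded P Z := hZ.center
  have hindc : iIndepFun Z P :=
    hind.comp (fun j x => x - ∫ ω', noiseFamily a ξ j ω' ∂P) fun j => measurable_id.sub_const _
  have h0 : ∀ j, ∫ ω, Z j ω ∂P = 0 := fun j => by
    simp [hZdef, integral_sub (hZ.integrable j) (integrable_const _)]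
  have hv : Tendsto (fun m => ∫ ω, Z (.inl m) ω ^ 2 ∂P) atTop (𝓝 (sa ^ 2)) :=
    tendsto_integral_center_sq (fun m => by
      simpa [noiseFamily] using hZ.memLp_two (.inl m.natPred)) ha_mean ha_var
  have hv' : Tendsto (fun m => ∫ ω, Z (.inr m) ω ^ 2 ∂P) atTop (𝓝 (sξ ^ 2)) :=
    tendsto_integral_center_sq (fun m => by
      simpa [noiseFamily] using hZ.memLp_two (.inr m.natPred)) hξ_mean hξ_var
  refine exists_gaussian_tendstoInDistribution (fun N => measurable_pi_lambda _ fun i =>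
    (measurable_scaledTrace hZ (hα i).2 _ _).sub_const _)
    (posSemidef_limitCovariance sa sξ α k hα hk) fun t => ?_
  have hlin := tendsto_charFun_sum_linearStat sa sξ α k t hZc hindc h0 hv hv' hα hk
  set R : ι → ℕ → Ω → ℝ := fun i N ω => traceRem a ξ (α i) (k i) N ω -
    ∫ ω', traceRem a ξ (α i) (k i) N ω' ∂P with hR
  have hRm : ∀ i N, Measurable (R i N) := fun i N =>
    (measurable_traceRem hZ (hα i).2 _ _).sub_const _
  have hRi : ∀ i N, Integrable (R i N) P := fun i N =>
    ((memLp_traceRem hZ (hα i).2 _ _).integrable one_le_two).sub (integrable_const _)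
  have hlm : ∀ i N, Measurable (linearStat Z (α i) (k i) N) := fun i N =>
    (Finset.measurable_sum _ fun m _ => ((hZc.measurable (.inl m)).const_mul _).add
      ((hZc.measurable (.inr m)).const_mul _)).const_mul _
  have hbound : Tendsto (fun N => ∑ i, |t i| * ∫ ω, |R i N ω| ∂P) atTop (𝓝 0) := by
    have := tendsto_finsetSum (Finset.univ : Finset ι) fun i _ =>
      (tendsto_integral_abs_traceRem_sub hZ hind (hα i).2 (k i)).const_mul |t i|
    simpa using this
  -- The centered remainders vanish in L¹, so adding them does not change the limiting
  -- characteristic function.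
  have hdiff := squeeze_zero_norm (f := fun N =>
    charFun (P.map fun ω => (∑ i, t i * linearStat Z (α i) (k i) N ω) + ∑ i, t i * R i N ω) 1 -
      charFun (P.map fun ω => ∑ i, t i * linearStat Z (α i) (k i) N ω) 1) (fun N => by
    refine (norm_charFun_add_sub_le (Finset.measurable_sum _ fun i _ => (hlm i N).const_mul _)
      (Finset.measurable_sum _ fun i _ => (hRm i N).const_mul _)
      (integrable_finsetSum _ fun i _ => (hRi i N).const_mul _)).trans ?_
    have hle : ∀ ω, |∑ i, t i * R i N ω| ≤ ∑ i, |t i| * |R i N ω| := fun ω => by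
      simpa only [abs_mul] using Finset.abs_sum_le_sum_abs (fun i => t i * R i N ω) Finset.univ
    have hi : ∀ i, Integrable (fun ω => |t i| * |R i N ω|) P := fun i => (hRi i N).abs.const_mul _
    refine (integral_mono (integrable_finsetSum _ fun i _ => (hRi i N).const_mul _).abs
      (integrable_finsetSum _ fun i _ => hi i) hle).trans (le_of_eq ?_)
    rw [integral_finsetSum _ fun i _ => hi i]
    simp only [integral_const_mul]) hbound
  have hsum := hdiff.add hlin
  rw [zero_add] at hsum
  refine hsum.congr fun N => ?_
  rw [sub_add_cancel]
  congr 2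
  ext ω
  simp only [scaledTrace_sub_integral hZ (hα _).2, mul_add, Finset.sum_add_distrib]
  rfl
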